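/- Let $\ell\ge 1$. Let $(M_0^{m_0},g_0)$ be an Einstein manifold of negative scalar curvature $\mathrm{Sc}(g_0)=-m_0(m_0-1)$, and let $(M_i^{m_i},g_i)$, $1\le i\le \ell$, be Einstein manifolds of positive scalar curvature $\mathrm{Sc}(g_i)=m_i(m_i-1)$; here all manifolds are smooth, without boundary and finite-dimensional, the metrics are pseudo-Riemannian of arbitrary signature, and the sign conditions on the scalar curvatures mean that $m_i\ge 2$ for $0\le i\le\ell$. Put $M^{0+}:=M_0$, $G^0:=g_0$, and for $1\le s\le \ell$ define recursively $$M^{s+}:=M^{(s-1)+}\times M_s\times(0,2),\qquad G^s:=r_s^{-2}\Big(dr_s^2+\big(1+\tfrac{r_s^2}{4}\big)^2G^{s-1}+\big(1-\tfrac{r_s^2}{4}\big)^2g_s\Big),$$ where $r_s$ is the coordinate on $(0,2)$. Let $\underline M^\ell:=M^{(\ell-1)+}\times M_\ell\times[0,2)$, a manifold with boundary $M^{(\ell-1)+}\times M_\ell\times\{0\}$ and interior $M^{\ell+}$. Then $\dim \underline M^\ell=\dim M^{\ell+}=\ell+\sum_{i=0}^{\ell}m_i$, and $G^\ell$ is a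 Poincaré–Einstein metric on $M^{\ell+}$ with conformal infinity $(M^{(\ell-1)+}\times M_\ell,[G^{\ell-1}\times g_\ell])$. That is: $G^\ell$ is a smooth pseudo-Riemannian metric with $\mathrm{Ric}(G^\ell)=-n\,G^\ell$, where $n=\dim \underline M^\ell-1$; the coordinate $r_\ell$ is a non-negative defining function for the boundary of $\underline M^\ell$ (it is smooth, its zero set is the boundary, and $dr_\ell\ne0$ there); $r_\ell^2G^\ell$ extends to a smooth (nondegenerate) pseudo-Riemannian metric on $\underline M^\ell$; and the restriction of this extension to the tangent spaces of the boundary $M^{(\ell-1)+}\times M_\ell$ is a metric in the conformal class of the product metric $G^{\ell-1}\times g_\ell$. (Compactness of $\underline M^\ell$ is not required of a Poincaré–Einstein metric.) -/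

import Mathlib

set_option maxSynthPendingDepth 3

open Set Topology TopologicalSpace Manifold Bundle
open scoped ContDiff

/-! ### Curvature of a metric on an open piece of a vector space

A metric on (an open piece of) a finite-dimensional vector space `E` is a function
`G : E → (E →L[ℝ] E →L[ℝ] ℝ)`. Derivatives are taken within a set `s` (the range of the model with
corners, i.e. all of `E` if there is no boundary). -/

namespace Coord

variable {E : Type*} [NormedAddCommGroup E] [NormedSpace ℝ E]

/-- The Koszul expression of first derivatives of the metric,
`(u, v, w) ↦ ∂_u G(v, w) + ∂_v G(u, w) - ∂_w G(u, v)`. -/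
noncomputable def koszul (G : E → E →L[ℝ] E →L[ℝ] ℝ) (s : Set E) (y : E) :
    E →L[ℝ] E →L[ℝ] E →L[ℝ] ℝ :=
  let D : E →L[ℝ] E →L[ℝ] E →L[ℝ] ℝ := fderivWithin ℝ G s y
  D + D.flip -
    ((ContinuousLinearMap.flipₗᵢ ℝ E E ℝ).toContinuousLinearEquiv :
      (E →L[ℝ] E →L[ℝ] ℝ) →L[ℝ] (E →L[ℝ] E →L[ℝ] ℝ)).comp D.flip

/-- The Christoffel symbols `Γ(u, v)` of the Levi-Civita connection of `G`, determined by
`2 G(Γ(u, v), w) = ∂_u G(v, w) + ∂_v G(u, w) - ∂_w G(u, v)`. The inverse of `G y` as a map from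
`E` to its dual raises the index. -/
noncomputable def christoffel (G : E → E →L[ℝ] E →L[ℝ] ℝ) (s : Set E) (y : E) :
    E →L[ℝ] E →L[ℝ] E :=
  (ContinuousLinearMap.compL ℝ E (E →L[ℝ] ℝ) E (ContinuousLinearMap.inverse (G y))).comp
    ((1 / 2 : ℝ) • koszul G s y)

/-- The curvature endomorphism `u ↦ R(u, v) w`, where
`R(u, v) w = (∂_u Γ)(v, w) - (∂_v Γ)(u, w) + Γ(u, Γ(v, w)) - Γ(v, Γ(u, w))`. -/
noncomputable def curvature (G : E → E →L[ℝ] E →L[ℝ] ℝ) (s : Set E) (y : E) (v w : E) :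
    E →L[ℝ] E :=
  let Γ : E →L[ℝ] E →L[ℝ] E := christoffel G s y
  let DΓ : E →L[ℝ] E →L[ℝ] E →L[ℝ] E := fderivWithin ℝ (christoffel G s) s y
  (DΓ.flip v).flip w - (DΓ v).flip w + Γ.flip (Γ v w) - (Γ v).comp (Γ.flip w)

/-- The Ricci tensor `Ric(v, w) = tr (u ↦ R(u, v) w)`. -/
noncomputable def ricci (G : E → E →L[ℝ] E →L[ℝ] ℝ) (s : Set E) (y : E) :
    E →ₗ[ℝ] E →ₗ[ℝ] ℝ :=
  LinearMap.mk₂ ℝ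
    (fun v w => LinearMap.trace ℝ E (curvature G s y v w : E →ₗ[ℝ] E))
    (fun v v' w => by
      rw [← map_add]
      congr 1
      ext u
      simp [curvature]
      abel)
    (fun c v w => by
      rw [← map_smul]
      congr 1
      ext u
      simp [curvature, smul_sub, smul_add])
    (fun v w w' => by
      rw [← map_add]
      congr 1
      ext u
      simp [curvature]
      abel)
    (fun c v w => by
      rw [← map_smul]
      congr 1
      ext u
      simp [curvature, smul_sub, smul_add])

/-- The scalar curvature: the trace of the Ricci tensor with respect to `G`, i.e. the trace of the
endomorphism obtained from the Ricci tensor by raising an index. -/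
noncomputable def scalar [FiniteDimensional ℝ E] (G : E → E →L[ℝ] E →L[ℝ] ℝ) (s : Set E)
    (y : E) : ℝ :=
  LinearMap.trace ℝ E
    (((ContinuousLinearMap.inverse (G y) : (E →L[ℝ] ℝ) →L[ℝ] E) : (E →L[ℝ] ℝ) →ₗ[ℝ] E) ∘ₗ
      (LinearMap.toContinuousLinearMap : (E →ₗ[ℝ] ℝ) ≃ₗ[ℝ] (E →L[ℝ] ℝ)).toLinearMap ∘ₗ
      ricci G s y)

end Coord

/-! ### Pseudo-Riemannian metrics on manifolds -/

section Manifolds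

variable {E : Type*} [NormedAddCommGroup E] [NormedSpace ℝ E]
  {H : Type*} [TopologicalSpace H] (I : ModelWithCorners ℝ E H)
  {M : Type*} [TopologicalSpace M] [ChartedSpace H M]
  {E' : Type*} [NormedAddCommGroup E'] [NormedSpace ℝ E']
  {H' : Type*} [TopologicalSpace H'] (I' : ModelWithCorners ℝ E' H')
  {M' : Type*} [TopologicalSpace M'] [ChartedSpace H' M']

variable (M) in
/-- A field of bilinear forms on the tangent spaces of `M`. -/
abbrev BilinField := ∀ x : M, TangentSpace I x →L[ℝ] TangentSpace I x →L[ℝ] ℝ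

/-- The pullback `(f^* g)_x (u, v) = g_{f x} (df u, df v)`. -/
noncomputable def pullback (f : M → M') (g : BilinField I' M') : BilinField I M := fun x =>
  let D : E →L[ℝ] E' := mfderiv I I' f x
  let b : E' →L[ℝ] E' →L[ℝ] ℝ := g (f x)
  (b.bilinearComp D D : E →L[ℝ] E →L[ℝ] ℝ)

/-- The square `df ⊗ df` of the differential of a real-valued function. -/
noncomputable def diffSq (f : M → ℝ) : BilinField I M :=
  pullback I 𝓘(ℝ, ℝ) f (fun _ => ContinuousLinearMap.mul ℝ ℝ)

/-- `g` is a smooth pseudo-Riemannian metric: a smooth section of the bundle of bilinear forms on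
the tangent bundle which is symmetric and nondegenerate at every point. -/
structure IsPseudoRiemannian [IsManifold I ∞ M] (g : BilinField I M) : Prop where
  symm : ∀ (x : M) (u v : TangentSpace I x), g x u v = g x v u
  nondegenerate : ∀ (x : M) (u : TangentSpace I x), (∀ v : TangentSpace I x, g x u v = 0) → u = 0
  contMDiff : ContMDiff I (I.prod 𝓘(ℝ, E →L[ℝ] E →L[ℝ] ℝ)) ∞
    (fun x : M => TotalSpace.mk' (E →L[ℝ] E →L[ℝ] ℝ)
      (E := fun x : M => TangentSpace I x →L[ℝ] TangentSpace I x →L[ℝ] ℝ) x (g x))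

/-- The expression of `g` in the preferred chart around `x`: the pullback of `g` under the inverse
of the chart. -/
noncomputable def chartMetric (g : BilinField I M) (x : M) : E → E →L[ℝ] E →L[ℝ] ℝ := fun y =>
  let D : E →L[ℝ] E := mfderivWithin 𝓘(ℝ, E) I (extChartAt I x).symm (range I) y
  let b : E →L[ℝ] E →L[ℝ] ℝ := g ((extChartAt I x).symm y)
  b.bilinearComp D D

/-- The Ricci tensor of `g` at `x`, computed in the preferred chart around `x`. The tangent space at
`x` is by definition the model vector space, through the differential at `x` of that chart. -/
noncomputable def ricciTensor (g : BilinField I M) (x : M) (u v : TangentSpace I x) : ℝ :=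
  Coord.ricci (chartMetric I g x) (range I) (extChartAt I x x) u v

/-- The scalar curvature of `g` at `x`. -/
noncomputable def scalarCurvature [FiniteDimensional ℝ E] (g : BilinField I M) (x : M) : ℝ :=
  Coord.scalar (chartMetric I g x) (range I) (extChartAt I x x)

/-- `Ric(g) = c g`. -/
def HasEinsteinConstant (g : BilinField I M) (c : ℝ) : Prop :=
  ∀ (x : M) (u v : TangentSpace I x), ricciTensor I g x u v = c * g x u v

/-- `g` is an Einstein metric: a pseudo-Riemannian metric with `Ric(g) = c g` for a constant `c`. -/
def IsEinstein [IsManifold I ∞ M] (g : BilinField I M) : Prop :=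
  IsPseudoRiemannian I g ∧ ∃ c : ℝ, HasEinsteinConstant I g c

/-- The product metric `g × g'` on `M × M'`. -/
noncomputable def prodMetric (g : BilinField I M) (g' : BilinField I' M') :
    BilinField (I.prod I') (M × M') := fun x =>
  pullback (I.prod I') I Prod.fst g x + pullback (I.prod I') I' Prod.snd g' x

/-! ### Poincaré–Einstein structures -/

variable {EX : Type*} [NormedAddCommGroup EX] [NormedSpace ℝ EX]
  {HX : Type*} [TopologicalSpace HX] (IX : ModelWithCorners ℝ EX HX)
  {X : Type*} [TopologicalSpace X] [ChartedSpace HX X]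

/-- `r` is a nonnegative smooth defining function for the boundary of `X`. -/
structure IsDefiningFunction (r : X → ℝ) : Prop where
  contMDiff : ContMDiff IX 𝓘(ℝ, ℝ) ∞ r
  nonneg : ∀ x, 0 ≤ r x
  eq_zero_iff : ∀ x, r x = 0 ↔ x ∈ IX.boundary X
  mfderiv_ne_zero : ∀ x ∈ IX.boundary X, mfderiv IX 𝓘(ℝ, ℝ) r x ≠ 0

/-- The metric `g` on the manifold `M` is Poincaré–Einstein with conformal infinity `(M', [h])`.
Here `X` is a manifold with boundary, `ι` identifies `M` with its interior, `j` identifies `M'` with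
its boundary, `r` is a defining function for the boundary, and the following is required:
`Ric(g) = -n g` with `n = dim M'`, the metric `r² g` extends to a smooth pseudo-Riemannian metric
`gbar` on all of `X`, and the restriction of `gbar` to the boundary lies in the conformal class of
`h`. -/
structure IsPoincareEinstein [IsManifold I ∞ M] [IsManifold I' ∞ M'] [IsManifold IX ∞ X]
    (ι : M → X) (j : M' → X) (r : X → ℝ) (g : BilinField I M) (h : BilinField I' M') : Prop where
  interior_embedding : IsSmoothEmbedding I IX ∞ ι
  range_interior : range ι = IX.interior X
  boundary_embedding : IsSmoothEmbedding I' IX ∞ j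
  range_boundary : range j = IX.boundary X
  definingFunction : IsDefiningFunction IX r
  metric : IsPseudoRiemannian I g
  boundaryMetric : IsPseudoRiemannian I' h
  einstein : HasEinsteinConstant I g (-(Module.finrank ℝ E' : ℝ))
  conformalInfinity : ∃ gbar : BilinField IX X, IsPseudoRiemannian IX gbar ∧
    (∀ x : M, pullback I IX ι gbar x = (r (ι x)) ^ 2 • g x) ∧
    ∃ φ : M' → ℝ, ContMDiff I' 𝓘(ℝ, ℝ) ∞ φ ∧ (∀ y, 0 < φ y) ∧
      ∀ y : M', pullback I' IX j gbar y = φ y • h y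

end Manifolds

/-! ### The recursive construction -/

universe u v w

/-- A finite-dimensional smooth manifold without boundary (Hausdorff and second countable), together
with a field of bilinear forms. That the latter is a pseudo-Riemannian metric is a separate
statement. -/
structure MetricManifold where
  carrier : Type u
  modelVec : Type v
  modelTop : Type w
  [normed : NormedAddCommGroup modelVec]
  [normedSpace : NormedSpace ℝ modelVec]
  [finiteDimensional : FiniteDimensional ℝ modelVec]
  [topModel : TopologicalSpace modelTop]
  model : ModelWithCorners ℝ modelVec modelTop
  [boundaryless : model.Boundaryless]
  [top : TopologicalSpace carrier]
  [t2 : T2Space carrier]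
  [secondCountable : SecondCountableTopology carrier]
  [charted : ChartedSpace modelTop carrier]
  [isManifold : IsManifold model ∞ carrier]
  metric : BilinField model carrier

namespace MetricManifold

attribute [instance] normed normedSpace finiteDimensional topModel boundaryless top t2
  secondCountable charted isManifold

/-- The dimension. -/
noncomputable def dim (P : MetricManifold.{u, v, w}) : ℕ := Module.finrank ℝ P.modelVec

/-- The open interval `(0, 2)`. -/
def openInterval : Opens ℝ := ⟨Ioo 0 2, isOpen_Ioo⟩

/-- The half-open interval `[0, 2)`, as an open piece of the one-dimensional half-space; it is a
manifold with boundary `{0}`. -/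
def halfOpenInterval : Opens (EuclideanHalfSpace 1) :=
  ⟨{t | t.1 0 < 2}, by
    have hc : Continuous fun t : EuclideanHalfSpace 1 => t.1 0 :=
      (PiLp.continuous_apply 2 _ 0).comp continuous_subtype_val
    exact isOpen_lt hc continuous_const⟩

/-- The inclusion of `(0, 2)` into `[0, 2)`. -/
def intervalIncl (t : openInterval) : halfOpenInterval :=
  ⟨⟨WithLp.toLp 2 fun _ => (t : ℝ), t.2.1.le⟩, t.2.2⟩

/-- The point `0` of `[0, 2)`. -/
def intervalZero : halfOpenInterval :=
  ⟨⟨WithLp.toLp 2 fun _ => 0, le_refl (0 : ℝ)⟩, show (0 : ℝ) < 2 by norm_num⟩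

/-- The sub-product of `(P, G)` and `(Q, g)`: the manifold `P × Q × (0, 2)` with the metric
`r⁻² (dr² + (1 + r²/4)² G + (1 - r²/4)² g)`, where `r` is the coordinate on `(0, 2)`. -/
noncomputable def subProduct (P Q : MetricManifold.{u, v, w}) : MetricManifold.{u, v, w} where
  carrier := P.carrier × Q.carrier × openInterval
  modelVec := P.modelVec × Q.modelVec × ℝ
  modelTop := ModelProd P.modelTop (ModelProd Q.modelTop ℝ)
  model := P.model.prod (Q.model.prod 𝓘(ℝ, ℝ))
  metric := fun x =>
    let J := P.model.prod (Q.model.prod 𝓘(ℝ, ℝ))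
    let r : P.carrier × Q.carrier × openInterval → ℝ := fun x => (x.2.2 : ℝ)
    ((r x) ^ 2)⁻¹ •
      (diffSq J r x
        + (1 + (r x) ^ 2 / 4) ^ 2 • pullback J P.model (fun x => x.1) P.metric x
        + (1 - (r x) ^ 2 / 4) ^ 2 • pullback J Q.model (fun x => x.2.1) Q.metric x)

/-- The manifold with boundary `P × Q × [0, 2)`. -/
abbrev SubProductBar (P Q : MetricManifold.{u, v, w}) : Type _ :=
  P.carrier × Q.carrier × halfOpenInterval

/-- The model with corners of `P × Q × [0, 2)`. -/
noncomputable abbrev modelBar (P Q : MetricManifold.{u, v, w}) :=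
  P.model.prod (Q.model.prod (𝓡∂ 1))

/-- The dimension of `P × Q × [0, 2)`, i.e. that of the vector space on which it is modelled. -/
noncomputable def dimBar (P Q : MetricManifold.{u, v, w}) : ℕ :=
  Module.finrank ℝ (P.modelVec × Q.modelVec × EuclideanSpace ℝ (Fin 1))

/-- The inclusion `P × Q × (0, 2) → P × Q × [0, 2)`. -/
def interiorIncl (P Q : MetricManifold.{u, v, w}) (x : (P.subProduct Q).carrier) : SubProductBar P Q :=
  (x.1, x.2.1, intervalIncl x.2.2)

/-- The map `P × Q → P × Q × [0, 2)`, `(p, q) ↦ (p, q, 0)`. -/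
def boundaryIncl (P Q : MetricManifold.{u, v, w}) (y : P.carrier × Q.carrier) : SubProductBar P Q :=
  (y.1, y.2, intervalZero)

/-- The coordinate `r` on the factor `[0, 2)` of `P × Q × [0, 2)`. -/
def coordR (P Q : MetricManifold.{u, v, w}) (x : SubProductBar P Q) : ℝ := x.2.2.1.1 0

/-- The recursively defined manifolds: the `0`-th one is `(M₀, g₀)`, and the `s`-th one is the
sub-product of the `(s - 1)`-st one and `(M_s, g_s)`. -/
noncomputable def tower (M : ℕ → MetricManifold.{u, v, w}) : ℕ → MetricManifold.{u, v, w}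
  | 0 => M 0
  | s + 1 => (tower M s).subProduct (M (s + 1))

end MetricManifold

/-!
The sub-product metric `r⁻² (dr² + (1 + r²/4)² G + (1 - r²/4)² g)` is, in the variable `t` with
`r = 2 e^{-t}`, the doubly warped product `dt² + cosh² t G + sinh² t g`. If `Ric(G) = -(p - 1) G`
and `Ric(g) = (q - 1) g`, where `p` and `q` are the dimensions, the identities `cosh'' = cosh`,
`sinh'' = sinh` and `cosh² - sinh² = 1` make its Ricci tensor `-(p + q)` times the metric, and
`p + q` is one less than the dimension of the sub-product. So the sub-product satisfies the
hypothesis on `G` again, and the construction can be iterated (`MetricManifold.tower_einstein`). The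
scalar curvature assumptions only serve to fix the Einstein constants `-(m₀ - 1)` and `m_i - 1`, by
taking traces (`hasEinsteinConstant_of_scalarCurvature`).

The curvature computation is done in a chart and stays in the variable `r`. The Christoffel symbols
of `c(r) dr² + α(r) A + β(r) B` on `V × W × ℝ` are explicit in those of `A` and `B`
(`Coord.christoffel_warped`). Differentiating them once more and taking the trace of the curvature
endomorphism block by block gives the Ricci tensor (`Coord.ricci_warped`), which is then specialised
to the three functions at hand (`Coord.ricci_warped_poincare`). That the chart expression of the
sub-product metric has this form, and that all fields in question are smooth, follows from one
description of the chart expression of a pullback (`chartMetric_pullback`), since these fields are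
built from pullbacks under the projections.

Multiplying by `r²` leaves `dr² + (1 + r²/4)² G + (1 - r²/4)² g`, which is smooth and nondegenerate
for `r ∈ [0, 2)` (`isPseudoRiemannian_threefoldMetric`); at `r = 0` it restricts to `G + g`.
-/

/-! ### Bilinear forms and traces -/

section LinearAlgebra

variable {E : Type*} [NormedAddCommGroup E] [NormedSpace ℝ E]
  {F : Type*} [NormedAddCommGroup F] [NormedSpace ℝ F]

/-- On a finite-dimensional space, a bilinear form with trivial left kernel is an isomorphism onto
the dual space, by equality of dimensions. -/
theorem isInvertible_of_nondegenerate [FiniteDimensional ℝ E] (b : E →L[ℝ] E →L[ℝ] ℝ)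
    (hb : ∀ u, (∀ v, b u v = 0) → u = 0) : b.IsInvertible := by
  have hinj : Function.Injective (b : E →ₗ[ℝ] E →L[ℝ] ℝ) := by
    rw [injective_iff_map_eq_zero]
    intro u hu
    exact hb u fun v => by simpa using congrArg (fun L : E →L[ℝ] ℝ => L v) hu
  have hdim : Module.finrank ℝ E = Module.finrank ℝ (E →L[ℝ] ℝ) := by
    rw [← (LinearMap.toContinuousLinearMap : (E →ₗ[ℝ] ℝ) ≃ₗ[ℝ] (E →L[ℝ] ℝ)).finrank_eq]
    exact (Subspace.dual_finrank_eq).symm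
  refine ⟨(LinearEquiv.ofInjectiveOfFinrankEq (b : E →ₗ[ℝ] E →L[ℝ] ℝ) hinj
    hdim).toContinuousLinearEquiv, ?_⟩
  ext u v
  rfl

theorem eventually_isInvertible [CompleteSpace E] {X : Type*} [TopologicalSpace X] {x : X}
    {b : X → E →L[ℝ] F} (hb : ContinuousAt b x) (hx : (b x).IsInvertible) :
    ∀ᶠ y in 𝓝 x, (b y).IsInvertible := by
  obtain ⟨e, he⟩ := hx
  exact hb.eventually (he ▸ e.nhds)

theorem eq_zero_of_isInvertible {b : E →L[ℝ] E →L[ℝ] ℝ} (hb : b.IsInvertible) {u : E}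
    (hu : ∀ v, b u v = 0) : u = 0 :=
  hb.injective (by ext v; simp [hu])

/-- The trace of an endomorphism of a product is the sum of the traces of its diagonal blocks. -/
theorem LinearMap.trace_prod_eq {V W : Type*} [AddCommGroup V] [Module ℝ V] [AddCommGroup W]
    [Module ℝ W] [FiniteDimensional ℝ V] [FiniteDimensional ℝ W] (T : V × W →ₗ[ℝ] V × W) :
    LinearMap.trace ℝ (V × W) T =
      LinearMap.trace ℝ V (LinearMap.fst ℝ V W ∘ₗ T ∘ₗ LinearMap.inl ℝ V W) +
      LinearMap.trace ℝ W (LinearMap.snd ℝ V W ∘ₗ T ∘ₗ LinearMap.inr ℝ V W) := by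
  have h : T = LinearMap.inl ℝ V W ∘ₗ (LinearMap.fst ℝ V W ∘ₗ T) +
      LinearMap.inr ℝ V W ∘ₗ (LinearMap.snd ℝ V W ∘ₗ T) := by
    ext x <;> simp
  conv_lhs => rw [h]
  rw [map_add, LinearMap.trace_comp_comm', LinearMap.trace_comp_comm' _ (LinearMap.inr ℝ V W)]
  rfl

theorem LinearMap.trace_real (T : ℝ →ₗ[ℝ] ℝ) : LinearMap.trace ℝ ℝ T = T 1 := by
  have h : T = T 1 • LinearMap.id := by ext; simp
  conv_lhs => rw [h]
  simp

theorem ContDiffWithinAt.bilinearComp {n : WithTop ℕ∞} {s : Set E} {x : E}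
    {b : E → F →L[ℝ] F →L[ℝ] ℝ} {D D' : E → E →L[ℝ] F} (hb : ContDiffWithinAt ℝ n b s x)
    (hD : ContDiffWithinAt ℝ n D s x) (hD' : ContDiffWithinAt ℝ n D' s x) :
    ContDiffWithinAt ℝ n (fun y => (b y).bilinearComp (D y) (D' y)) s x := by
  have h1 : ContDiffWithinAt ℝ n (fun y => ((b y).comp (D y)).flip) s x :=
    (ContinuousLinearMap.flipₗᵢ ℝ E F ℝ).contDiff.contDiffAt.comp_contDiffWithinAt x
      (hb.clm_comp hD)
  exact (ContinuousLinearMap.flipₗᵢ ℝ E E ℝ).contDiff.contDiffAt.comp_contDiffWithinAt x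
      (h1.clm_comp hD')

end LinearAlgebra

/-! ### Christoffel symbols and curvature on an open piece of a vector space -/

namespace Coord

variable {E : Type*} [NormedAddCommGroup E] [NormedSpace ℝ E]
  {F : Type*} [NormedAddCommGroup F] [NormedSpace ℝ F]

theorem hasFDerivAt_apply_apply {F' : Type*} [NormedAddCommGroup F'] [NormedSpace ℝ F']
    {b : E → F →L[ℝ] F →L[ℝ] F'} {y : E} (hb : DifferentiableAt ℝ b y) (v w : F) :
    HasFDerivAt (fun z => b z v w) (((fderiv ℝ b y).flip v).flip w) y := by
  have h := (hb.hasFDerivAt.clm_apply (hasFDerivAt_const v y)).clm_apply (hasFDerivAt_const w y)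
  refine h.congr_fderiv ?_
  ext u
  simp

variable {G : E → E →L[ℝ] E →L[ℝ] ℝ} {y : E}

theorem koszul_univ_apply (G : E → E →L[ℝ] E →L[ℝ] ℝ) (y u v w : E) :
    koszul G univ y u v w = fderiv ℝ G y u v w + fderiv ℝ G y v u w - fderiv ℝ G y w u v := by
  simp [koszul, fderivWithin_univ]

/-- The Koszul formula. -/
theorem apply_christoffel (hG : (G y).IsInvertible) (u v w : E) :
    G y (christoffel G univ y u v) w = 1 / 2 * koszul G univ y u v w := by
  simp [christoffel, hG.self_apply_inverse]

theorem christoffel_eq_of_forall (hG : (G y).IsInvertible) {u v X : E}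
    (hX : ∀ w, G y X w = 1 / 2 * koszul G univ y u v w) : christoffel G univ y u v = X := by
  apply hG.injective
  ext w
  rw [apply_christoffel hG, hX]

theorem fderiv_symm (hG : DifferentiableAt ℝ G y) (hsymm : ∀ z u v, G z u v = G z v u)
    (u v w : E) : fderiv ℝ G y u v w = fderiv ℝ G y u w v := by
  have h1 := hasFDerivAt_apply_apply hG v w
  have h2 := hasFDerivAt_apply_apply hG w v
  have h3 : (fun z => G z v w) = fun z => G z w v := by ext z; exact hsymm z v w
  rw [h3] at h1
  simpa using congrArg (fun L : E →L[ℝ] ℝ => L u) (h1.unique h2)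

/-- The Levi-Civita connection is torsion-free. -/
theorem christoffel_symm (hG : DifferentiableAt ℝ G y) (hsymm : ∀ z u v, G z u v = G z v u)
    (hinv : (G y).IsInvertible) (u v : E) :
    christoffel G univ y u v = christoffel G univ y v u := by
  refine christoffel_eq_of_forall hinv fun w => ?_
  rw [apply_christoffel hinv, koszul_univ_apply, koszul_univ_apply, fderiv_symm hG hsymm w u v]
  ring

theorem differentiableAt_christoffel [CompleteSpace E] (hG : ContDiffAt ℝ 2 G y)
    (hinv : (G y).IsInvertible) : DifferentiableAt ℝ (christoffel G univ) y := by
  have h1 : DifferentiableAt ℝ (fun z => ContinuousLinearMap.inverse (G z)) y :=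
    ((hinv.contDiffAt_map_inverse (n := 2)).comp y hG).differentiableAt (by simp)
  have h2 : DifferentiableAt ℝ (fderiv ℝ G) y :=
    (hG.fderiv_right (m := 1) (by norm_num)).differentiableAt (by simp)
  have h3 : DifferentiableAt ℝ (koszul G univ) y := by
    unfold koszul
    simp only [fderivWithin_univ]
    have hf : DifferentiableAt ℝ (fun z => (fderiv ℝ G z).flip) y :=
      (ContinuousLinearMap.flipₗᵢ ℝ E E (E →L[ℝ] ℝ)).differentiableAt.comp y h2
    exact (h2.add hf).sub ((differentiableAt_const _).clm_comp hf)
  unfold christoffel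
  exact ((ContinuousLinearMap.differentiableAt _).comp y h1).clm_comp (h3.fun_const_smul _)

theorem koszul_congr {G' : E → E →L[ℝ] E →L[ℝ] ℝ} (h : G =ᶠ[𝓝 y] G') :
    koszul G univ =ᶠ[𝓝 y] koszul G' univ := by
  filter_upwards [h.fderiv (𝕜 := ℝ)] with z hz
  simp only [koszul, fderivWithin_univ, hz]

theorem christoffel_congr {G' : E → E →L[ℝ] E →L[ℝ] ℝ} (h : G =ᶠ[𝓝 y] G') :
    christoffel G univ =ᶠ[𝓝 y] christoffel G' univ := by
  filter_upwards [h, koszul_congr h] with z hz hz'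
  simp only [christoffel, hz, hz']

theorem curvature_congr {G' : E → E →L[ℝ] E →L[ℝ] ℝ} (h : G =ᶠ[𝓝 y] G') (v w : E) :
    curvature G univ y v w = curvature G' univ y v w := by
  have h' := christoffel_congr h
  simp only [curvature, fderivWithin_univ, h'.eq_of_nhds, h'.fderiv_eq]

/-- The Ricci tensor at a point depends only on the germ of the metric there. -/
theorem ricci_congr {G' : E → E →L[ℝ] E →L[ℝ] ℝ} (h : G =ᶠ[𝓝 y] G') :
    ricci G univ y = ricci G' univ y := by
  ext v w
  simp only [ricci, LinearMap.mk₂_apply, curvature_congr h]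

theorem curvature_univ_apply (G : E → E →L[ℝ] E →L[ℝ] ℝ) (y u v w : E) :
    curvature G univ y v w u =
      fderiv ℝ (christoffel G univ) y u v w - fderiv ℝ (christoffel G univ) y v u w
        + christoffel G univ y u (christoffel G univ y v w)
        - christoffel G univ y v (christoffel G univ y u w) := by
  simp [curvature, fderivWithin_univ]

theorem ricci_apply (G : E → E →L[ℝ] E →L[ℝ] ℝ) (s : Set E) (y v w : E) :
    ricci G s y v w = LinearMap.trace ℝ E (curvature G s y v w : E →ₗ[ℝ] E) := rfl

/-- Tracing `Ric = c G` with respect to `G` gives `c` times the dimension. -/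
theorem scalar_eq_of_ricci_eq [FiniteDimensional ℝ E] {s : Set E} {c : ℝ}
    (hinv : (G y).IsInvertible) (hric : ∀ u v, ricci G s y u v = c * G y u v) :
    scalar G s y = c * Module.finrank ℝ E := by
  have h : (((ContinuousLinearMap.inverse (G y) : (E →L[ℝ] ℝ) →L[ℝ] E) : (E →L[ℝ] ℝ) →ₗ[ℝ] E) ∘ₗ
      (LinearMap.toContinuousLinearMap : (E →ₗ[ℝ] ℝ) ≃ₗ[ℝ] (E →L[ℝ] ℝ)).toLinearMap ∘ₗ
      ricci G s y) = c • LinearMap.id := by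
    ext u
    apply hinv.injective
    ext v
    simp [hinv.self_apply_inverse, hric]
  rw [scalar, h]
  simp

end Coord

/-! ### The Ricci tensor of a doubly warped product -/

namespace Coord

variable {V : Type*} [NormedAddCommGroup V] [NormedSpace ℝ V]
  {W : Type*} [NormedAddCommGroup W] [NormedSpace ℝ W]

/-- The doubly warped product metric `c(r) dr² + α(r) A + β(r) B` on an open piece of `V × W × ℝ`,
where `r` is the last coordinate. -/
noncomputable def warped (c α β : ℝ → ℝ) (A : V → V →L[ℝ] V →L[ℝ] ℝ) (B : W → W →L[ℝ] W →L[ℝ] ℝ) :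
    V × W × ℝ → V × W × ℝ →L[ℝ] V × W × ℝ →L[ℝ] ℝ := fun z =>
  let p₁ : V × W × ℝ →L[ℝ] V := ContinuousLinearMap.fst ℝ V (W × ℝ)
  let p₂ : V × W × ℝ →L[ℝ] W :=
    (ContinuousLinearMap.fst ℝ W ℝ).comp (ContinuousLinearMap.snd ℝ V (W × ℝ))
  let p₃ : V × W × ℝ →L[ℝ] ℝ :=
    (ContinuousLinearMap.snd ℝ W ℝ).comp (ContinuousLinearMap.snd ℝ V (W × ℝ))
  c z.2.2 • (ContinuousLinearMap.mul ℝ ℝ).bilinearComp p₃ p₃ +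
    α z.2.2 • (A z.1).bilinearComp p₁ p₁ + β z.2.2 • (B z.2.1).bilinearComp p₂ p₂

variable {c α β : ℝ → ℝ} {A : V → V →L[ℝ] V →L[ℝ] ℝ} {B : W → W →L[ℝ] W →L[ℝ] ℝ}

theorem warped_apply (z v w : V × W × ℝ) : warped c α β A B z v w =
    c z.2.2 * (v.2.2 * w.2.2) + α z.2.2 * A z.1 v.1 w.1 + β z.2.2 * B z.2.1 v.2.1 w.2.1 := by
  simp [warped]

theorem contDiffAt_warped {z : V × W × ℝ} {n : WithTop ℕ∞} (hc : ContDiffAt ℝ n c z.2.2)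
    (hα : ContDiffAt ℝ n α z.2.2) (hβ : ContDiffAt ℝ n β z.2.2) (hA : ContDiffAt ℝ n A z.1)
    (hB : ContDiffAt ℝ n B z.2.1) : ContDiffAt ℝ n (warped c α β A B) z := by
  have h3 : ContDiffAt ℝ n (fun z : V × W × ℝ => z.2.2) z := by fun_prop
  have h2 : ContDiffAt ℝ n (fun z : V × W × ℝ => z.2.1) z := by fun_prop
  have h1 : ContDiffAt ℝ n (fun z : V × W × ℝ => z.1) z := by fun_prop
  let p₁ : V × W × ℝ →L[ℝ] V := ContinuousLinearMap.fst ℝ V (W × ℝ)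
  let p₂ : V × W × ℝ →L[ℝ] W :=
    (ContinuousLinearMap.fst ℝ W ℝ).comp (ContinuousLinearMap.snd ℝ V (W × ℝ))
  let p₃ : V × W × ℝ →L[ℝ] ℝ :=
    (ContinuousLinearMap.snd ℝ W ℝ).comp (ContinuousLinearMap.snd ℝ V (W × ℝ))
  have hA' : ContDiffAt ℝ n (fun z : V × W × ℝ => (A z.1).bilinearComp p₁ p₁) z :=
    ContDiffWithinAt.bilinearComp (s := univ) (hA.comp z h1) contDiffWithinAt_const
      contDiffWithinAt_const
  have hB' : ContDiffAt ℝ n (fun z : V × W × ℝ => (B z.2.1).bilinearComp p₂ p₂) z :=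
    ContDiffWithinAt.bilinearComp (s := univ) (hB.comp z h2) contDiffWithinAt_const
      contDiffWithinAt_const
  have hc' : ContDiffAt ℝ n (fun z : V × W × ℝ => c z.2.2) z := hc.comp z h3
  have hα' : ContDiffAt ℝ n (fun z : V × W × ℝ => α z.2.2) z := hα.comp z h3
  have hβ' : ContDiffAt ℝ n (fun z : V × W × ℝ => β z.2.2) z := hβ.comp z h3
  have h0 : ContDiffAt ℝ n
      (fun _ : V × W × ℝ => (ContinuousLinearMap.mul ℝ ℝ).bilinearComp p₃ p₃) z :=
    contDiffAt_const
  exact ((hc'.smul h0).add (hα'.smul hA')).add (hβ'.smul hB')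

theorem isInvertible_warped [FiniteDimensional ℝ V] [FiniteDimensional ℝ W] {z : V × W × ℝ}
    (hc : c z.2.2 ≠ 0) (hα : α z.2.2 ≠ 0) (hβ : β z.2.2 ≠ 0) (hA : (A z.1).IsInvertible)
    (hB : (B z.2.1).IsInvertible) : (warped c α β A B z).IsInvertible := by
  refine isInvertible_of_nondegenerate _ fun u hu => ?_
  have h1 : u.1 = 0 := eq_zero_of_isInvertible hA fun v => by
    simpa [warped_apply, hα] using hu (v, 0, 0)
  have h2 : u.2.1 = 0 := eq_zero_of_isInvertible hB fun v => by
    simpa [warped_apply, hβ] using hu (0, v, 0)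
  have h3 : u.2.2 = 0 := by simpa [warped_apply, hc] using hu (0, 0, 1)
  ext <;> simp [h1, h2, h3]

theorem fderiv_warped {z : V × W × ℝ} {c' α' β' : ℝ} (hc : HasDerivAt c c' z.2.2)
    (hα : HasDerivAt α α' z.2.2) (hβ : HasDerivAt β β' z.2.2) (hA : DifferentiableAt ℝ A z.1)
    (hB : DifferentiableAt ℝ B z.2.1) (hG : DifferentiableAt ℝ (warped c α β A B) z)
    (u v w : V × W × ℝ) :
    fderiv ℝ (warped c α β A B) z u v w = c' * u.2.2 * (v.2.2 * w.2.2) +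
      (α' * u.2.2 * A z.1 v.1 w.1 + α z.2.2 * fderiv ℝ A z.1 u.1 v.1 w.1) +
      (β' * u.2.2 * B z.2.1 v.2.1 w.2.1 + β z.2.2 * fderiv ℝ B z.2.1 u.2.1 v.2.1 w.2.1) := by
  have h3 : HasFDerivAt (fun z : V × W × ℝ => z.2.2)
    ((ContinuousLinearMap.snd ℝ W ℝ).comp (ContinuousLinearMap.snd ℝ V (W × ℝ))) z :=
    ((ContinuousLinearMap.snd ℝ W ℝ).comp (ContinuousLinearMap.snd ℝ V (W × ℝ))).hasFDerivAt
  have h2 : HasFDerivAt (fun z : V × W × ℝ => z.2.1)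
    ((ContinuousLinearMap.fst ℝ W ℝ).comp (ContinuousLinearMap.snd ℝ V (W × ℝ))) z :=
    ((ContinuousLinearMap.fst ℝ W ℝ).comp (ContinuousLinearMap.snd ℝ V (W × ℝ))).hasFDerivAt
  have h1 : HasFDerivAt (fun z : V × W × ℝ => z.1) (ContinuousLinearMap.fst ℝ V (W × ℝ)) z :=
    (ContinuousLinearMap.fst ℝ V (W × ℝ)).hasFDerivAt
  have hA' := HasFDerivAt.comp (f := fun z : V × W × ℝ => z.1) z
    (hasFDerivAt_apply_apply hA v.1 w.1) h1
  have hB' := HasFDerivAt.comp (f := fun z : V × W × ℝ => z.2.1) z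
    (hasFDerivAt_apply_apply hB v.2.1 w.2.1) h2
  have key := (((hc.comp_hasFDerivAt (f := fun z : V × W × ℝ => z.2.2) z h3).mul_const
      (v.2.2 * w.2.2)).add
    ((hα.comp_hasFDerivAt (f := fun z : V × W × ℝ => z.2.2) z h3).mul hA')).add
    ((hβ.comp_hasFDerivAt (f := fun z : V × W × ℝ => z.2.2) z h3).mul hB')
  have h := (hasFDerivAt_apply_apply hG v w).unique
    (key.congr_of_eventuallyEq (Filter.Eventually.of_forall fun x => by simp [warped_apply]))
  have h' := congrArg (fun L : V × W × ℝ →L[ℝ] ℝ => L u) h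
  simp only [ContinuousLinearMap.flip_apply] at h'
  rw [h']
  simp
  ring

/-- The Christoffel symbols of a doubly warped product. The warping functions enter through the
logarithmic derivatives `κ = α' / (2α)`, `ν = β' / (2β)`, `μ = c' / (2c)` and through
`ρ = α' / (2c)`, `σ = β' / (2c)`. -/
theorem christoffel_warped [FiniteDimensional ℝ V] [FiniteDimensional ℝ W] {z : V × W × ℝ}
    {κ ν μ ρ σ : ℝ} (hc : HasDerivAt c (2 * μ * c z.2.2) z.2.2)
    (hα : HasDerivAt α (2 * κ * α z.2.2) z.2.2) (hβ : HasDerivAt β (2 * ν * β z.2.2) z.2.2)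
    (hρ : ρ * c z.2.2 = κ * α z.2.2) (hσ : σ * c z.2.2 = ν * β z.2.2)
    (hA : DifferentiableAt ℝ A z.1) (hB : DifferentiableAt ℝ B z.2.1)
    (hAi : (A z.1).IsInvertible) (hBi : (B z.2.1).IsInvertible)
    (hAs : ∀ z u v, A z u v = A z v u) (hBs : ∀ z u v, B z u v = B z v u)
    (hG : DifferentiableAt ℝ (warped c α β A B) z) (hGi : (warped c α β A B z).IsInvertible)
    (v w : V × W × ℝ) :
    christoffel (warped c α β A B) univ z v w =
      (christoffel A univ z.1 v.1 w.1 + κ • (v.2.2 • w.1 + w.2.2 • v.1),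
        christoffel B univ z.2.1 v.2.1 w.2.1 + ν • (v.2.2 • w.2.1 + w.2.2 • v.2.1),
        μ * (v.2.2 * w.2.2) - ρ * A z.1 v.1 w.1 - σ * B z.2.1 v.2.1 w.2.1) := by
  refine christoffel_eq_of_forall hGi fun x => ?_
  rw [koszul_univ_apply, fderiv_warped hc hα hβ hA hB hG, fderiv_warped hc hα hβ hA hB hG,
    fderiv_warped hc hα hβ hA hB hG, warped_apply]
  simp only [map_add, map_smul, add_apply, smul_apply,
    apply_christoffel hAi, apply_christoffel hBi, koszul_univ_apply, smul_eq_mul]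
  rw [hAs _ v.1 w.1, hBs _ v.2.1 w.2.1]
  linear_combination (-(A z.1 w.1 v.1) * x.2.2) * hρ - (B z.2.1 w.2.1 v.2.1) * x.2.2 * hσ

/-- The derivative of the right-hand side of `christoffel_warped` with respect to the base point. -/
theorem fderiv_christoffel_warped {y : V × W × ℝ} {κ ν μ ρ σ : ℝ → ℝ} {κ' ν' μ' ρ' σ' : ℝ}
    (hκ : HasDerivAt κ κ' y.2.2) (hν : HasDerivAt ν ν' y.2.2) (hμ : HasDerivAt μ μ' y.2.2)
    (hρ : HasDerivAt ρ ρ' y.2.2) (hσ : HasDerivAt σ σ' y.2.2)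
    (hA : DifferentiableAt ℝ A y.1) (hB : DifferentiableAt ℝ B y.2.1)
    (hΓA : DifferentiableAt ℝ (christoffel A univ) y.1)
    (hΓB : DifferentiableAt ℝ (christoffel B univ) y.2.1) (u v w : V × W × ℝ) :
    fderiv ℝ (fun z : V × W × ℝ =>
      (christoffel A univ z.1 v.1 w.1 + κ z.2.2 • (v.2.2 • w.1 + w.2.2 • v.1),
        christoffel B univ z.2.1 v.2.1 w.2.1 + ν z.2.2 • (v.2.2 • w.2.1 + w.2.2 • v.2.1),
        μ z.2.2 * (v.2.2 * w.2.2) - ρ z.2.2 * A z.1 v.1 w.1 - σ z.2.2 * B z.2.1 v.2.1 w.2.1))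
      y u =
      (fderiv ℝ (christoffel A univ) y.1 u.1 v.1 w.1 +
          (κ' * u.2.2) • (v.2.2 • w.1 + w.2.2 • v.1),
        fderiv ℝ (christoffel B univ) y.2.1 u.2.1 v.2.1 w.2.1 +
          (ν' * u.2.2) • (v.2.2 • w.2.1 + w.2.2 • v.2.1),
        μ' * u.2.2 * (v.2.2 * w.2.2) -
          (ρ' * u.2.2 * A y.1 v.1 w.1 + ρ y.2.2 * fderiv ℝ A y.1 u.1 v.1 w.1) -
          (σ' * u.2.2 * B y.2.1 v.2.1 w.2.1 + σ y.2.2 * fderiv ℝ B y.2.1 u.2.1 v.2.1 w.2.1)) := by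
  have h3 : HasFDerivAt (fun z : V × W × ℝ => z.2.2)
    ((ContinuousLinearMap.snd ℝ W ℝ).comp (ContinuousLinearMap.snd ℝ V (W × ℝ))) y :=
    ((ContinuousLinearMap.snd ℝ W ℝ).comp (ContinuousLinearMap.snd ℝ V (W × ℝ))).hasFDerivAt
  have h2 : HasFDerivAt (fun z : V × W × ℝ => z.2.1)
    ((ContinuousLinearMap.fst ℝ W ℝ).comp (ContinuousLinearMap.snd ℝ V (W × ℝ))) y :=
    ((ContinuousLinearMap.fst ℝ W ℝ).comp (ContinuousLinearMap.snd ℝ V (W × ℝ))).hasFDerivAt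
  have h1 : HasFDerivAt (fun z : V × W × ℝ => z.1) (ContinuousLinearMap.fst ℝ V (W × ℝ)) y :=
    (ContinuousLinearMap.fst ℝ V (W × ℝ)).hasFDerivAt
  have hA' := HasFDerivAt.comp (f := fun z : V × W × ℝ => z.1) y
    (hasFDerivAt_apply_apply hA v.1 w.1) h1
  have hB' := HasFDerivAt.comp (f := fun z : V × W × ℝ => z.2.1) y
    (hasFDerivAt_apply_apply hB v.2.1 w.2.1) h2
  have hΓA' := HasFDerivAt.comp (f := fun z : V × W × ℝ => z.1) y
    (hasFDerivAt_apply_apply hΓA v.1 w.1) h1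
  have hΓB' := HasFDerivAt.comp (f := fun z : V × W × ℝ => z.2.1) y
    (hasFDerivAt_apply_apply hΓB v.2.1 w.2.1) h2
  have hκ' := hκ.comp_hasFDerivAt (f := fun z : V × W × ℝ => z.2.2) y h3
  have hν' := hν.comp_hasFDerivAt (f := fun z : V × W × ℝ => z.2.2) y h3
  have hμ' := hμ.comp_hasFDerivAt (f := fun z : V × W × ℝ => z.2.2) y h3
  have hρ' := hρ.comp_hasFDerivAt (f := fun z : V × W × ℝ => z.2.2) y h3
  have hσ' := hσ.comp_hasFDerivAt (f := fun z : V × W × ℝ => z.2.2) y h3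
  have key := (hΓA'.add (hκ'.smul_const (v.2.2 • w.1 + w.2.2 • v.1))).prodMk
    ((hΓB'.add (hν'.smul_const (v.2.2 • w.2.1 + w.2.2 • v.2.1))).prodMk
      (((hμ'.mul_const (v.2.2 * w.2.2)).sub (hρ'.mul hA')).sub (hσ'.mul hB')))
  refine (congrArg (fun L : V × W × ℝ →L[ℝ] V × W × ℝ => L u) key.fderiv).trans ?_
  ext
  · simp
  · simp
  · simp
    ring

/-- The Ricci tensor of the doubly warped product `c(r) dr² + α(r) A + β(r) B`, in terms of
`κ = α' / (2α)`, `ν = β' / (2β)`, `μ = c' / (2c)`, `ρ = α' / (2c)` and `σ = β' / (2c)`. -/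
theorem ricci_warped [FiniteDimensional ℝ V] [FiniteDimensional ℝ W] {y : V × W × ℝ}
    {κ ν μ ρ σ : ℝ → ℝ} {κ' ν' μ' ρ' σ' : ℝ}
    (hκ : HasDerivAt κ κ' y.2.2) (hν : HasDerivAt ν ν' y.2.2) (hμ : HasDerivAt μ μ' y.2.2)
    (hρ : HasDerivAt ρ ρ' y.2.2) (hσ : HasDerivAt σ σ' y.2.2)
    (hc' : ∀ᶠ r in 𝓝 y.2.2, HasDerivAt c (2 * μ r * c r) r)
    (hα' : ∀ᶠ r in 𝓝 y.2.2, HasDerivAt α (2 * κ r * α r) r)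
    (hβ' : ∀ᶠ r in 𝓝 y.2.2, HasDerivAt β (2 * ν r * β r) r)
    (hρc : ∀ᶠ r in 𝓝 y.2.2, ρ r * c r = κ r * α r)
    (hσc : ∀ᶠ r in 𝓝 y.2.2, σ r * c r = ν r * β r)
    (hc : ContDiffAt ℝ 2 c y.2.2) (hα : ContDiffAt ℝ 2 α y.2.2) (hβ : ContDiffAt ℝ 2 β y.2.2)
    (hc0 : c y.2.2 ≠ 0) (hα0 : α y.2.2 ≠ 0) (hβ0 : β y.2.2 ≠ 0)
    (hA : ContDiffAt ℝ 2 A y.1) (hB : ContDiffAt ℝ 2 B y.2.1)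
    (hAi : (A y.1).IsInvertible) (hBi : (B y.2.1).IsInvertible)
    (hAs : ∀ z u v, A z u v = A z v u) (hBs : ∀ z u v, B z u v = B z v u) (v w : V × W × ℝ) :
    ricci (warped c α β A B) univ y v w =
      ricci A univ y.1 v.1 w.1 + ricci B univ y.2.1 v.2.1 w.2.1
      - (Module.finrank ℝ V * (κ' + κ y.2.2 ^ 2 - κ y.2.2 * μ y.2.2) +
          Module.finrank ℝ W * (ν' + ν y.2.2 ^ 2 - ν y.2.2 * μ y.2.2)) * (v.2.2 * w.2.2)
      + ((2 - Module.finrank ℝ V) * (κ y.2.2 * ρ y.2.2) - Module.finrank ℝ W * (ν y.2.2 * ρ y.2.2)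
          - ρ' - μ y.2.2 * ρ y.2.2) * A y.1 v.1 w.1
      + ((2 - Module.finrank ℝ W) * (ν y.2.2 * σ y.2.2) - Module.finrank ℝ V * (κ y.2.2 * σ y.2.2)
          - σ' - μ y.2.2 * σ y.2.2) * B y.2.1 v.2.1 w.2.1 := by
  have : CompleteSpace V := FiniteDimensional.complete ℝ V
  have : CompleteSpace W := FiniteDimensional.complete ℝ W
  have h3 : ContinuousAt (fun z : V × W × ℝ => z.2.2) y := by fun_prop
  have h2 : ContinuousAt (fun z : V × W × ℝ => z.2.1) y := by fun_prop
  have h1 : ContinuousAt (fun z : V × W × ℝ => z.1) y := by fun_prop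
  have hG : ContDiffAt ℝ 2 (warped c α β A B) y := contDiffAt_warped hc hα hβ hA hB
  have hGi : (warped c α β A B y).IsInvertible := isInvertible_warped hc0 hα0 hβ0 hAi hBi
  have hΓ : ∀ᶠ z in 𝓝 y, ∀ v w : V × W × ℝ, christoffel (warped c α β A B) univ z v w =
      (christoffel A univ z.1 v.1 w.1 + κ z.2.2 • (v.2.2 • w.1 + w.2.2 • v.1),
        christoffel B univ z.2.1 v.2.1 w.2.1 + ν z.2.2 • (v.2.2 • w.2.1 + w.2.2 • v.2.1),
        μ z.2.2 * (v.2.2 * w.2.2) - ρ z.2.2 * A z.1 v.1 w.1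
          - σ z.2.2 * B z.2.1 v.2.1 w.2.1) := by
    filter_upwards [h3.eventually hc', h3.eventually hα', h3.eventually hβ', h3.eventually hρc,
      h3.eventually hσc, h1.eventually (hA.eventually (by simp)),
      h2.eventually (hB.eventually (by simp)),
      h1.eventually (eventually_isInvertible hA.continuousAt hAi),
      h2.eventually (eventually_isInvertible hB.continuousAt hBi), hG.eventually (by simp),
      eventually_isInvertible hG.continuousAt hGi]
      with z hc hα hβ hρ hσ hA hB hAi hBi hG hGi v w
    exact christoffel_warped hc hα hβ hρ hσ (hA.differentiableAt (by simp))
      (hB.differentiableAt (by simp)) hAi hBi hAs hBs (hG.differentiableAt (by simp)) hGi v w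
  have hdA := hA.differentiableAt (n := 2) (by simp)
  have hdB := hB.differentiableAt (n := 2) (by simp)
  have hD : ∀ u v w : V × W × ℝ, fderiv ℝ (christoffel (warped c α β A B) univ) y u v w =
      fderiv ℝ (fun z => christoffel (warped c α β A B) univ z v w) y u := fun u v w => by
    rw [(hasFDerivAt_apply_apply (differentiableAt_christoffel hG hGi) v w).fderiv]
    simp
  have hDΓ := fun u v w => (hD u v w).trans <|
    (congrArg (fun L : V × W × ℝ →L[ℝ] V × W × ℝ => L u)
      (Filter.EventuallyEq.fderiv_eq (hΓ.mono fun z hz => hz v w))).trans <|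
    fderiv_christoffel_warped hκ hν hμ hρ hσ hdA hdB
      (differentiableAt_christoffel hA hAi) (differentiableAt_christoffel hB hBi) u v w
  have hΓy := hΓ.self_of_nhds
  have hAt := christoffel_symm hdA hAs hAi
  have hBt := christoffel_symm hdB hBs hBi
  -- Outside the Christoffel symbols of `A` and `B`, derivatives of these forms occur only in the last
  -- component of the derivative of `Γ`, and vanish there in the diagonal blocks of `u ↦ R(u, v) w`.
  rw [ricci_apply, LinearMap.trace_prod_eq, LinearMap.trace_prod_eq]
  have e1 : LinearMap.fst ℝ V (W × ℝ) ∘ₗ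
      (curvature (warped c α β A B) univ y v w : V × W × ℝ →ₗ[ℝ] V × W × ℝ) ∘ₗ
        LinearMap.inl ℝ V (W × ℝ) =
      (curvature A univ y.1 v.1 w.1 : V →ₗ[ℝ] V) +
      (-(κ' + κ y.2.2 ^ 2) * (v.2.2 * w.2.2) + κ y.2.2 * (μ y.2.2 * (v.2.2 * w.2.2) -
        ρ y.2.2 * A y.1 v.1 w.1 - σ y.2.2 * B y.2.1 v.2.1 w.2.1)) • LinearMap.id +
      (κ y.2.2 * ρ y.2.2) • ((A y.1 w.1 : V →ₗ[ℝ] ℝ).smulRight v.1) := by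
    ext u
    simp [curvature_univ_apply, hDΓ, hΓy, hAs _ u w.1, hAt v.1 u]
    module
  have e2 : LinearMap.fst ℝ W ℝ ∘ₗ (LinearMap.snd ℝ V (W × ℝ) ∘ₗ
      (curvature (warped c α β A B) univ y v w : V × W × ℝ →ₗ[ℝ] V × W × ℝ) ∘ₗ
        LinearMap.inr ℝ V (W × ℝ)) ∘ₗ LinearMap.inl ℝ W ℝ =
      (curvature B univ y.2.1 v.2.1 w.2.1 : W →ₗ[ℝ] W) +
      (-(ν' + ν y.2.2 ^ 2) * (v.2.2 * w.2.2) + ν y.2.2 * (μ y.2.2 * (v.2.2 * w.2.2) -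
        ρ y.2.2 * A y.1 v.1 w.1 - σ y.2.2 * B y.2.1 v.2.1 w.2.1)) • LinearMap.id +
      (ν y.2.2 * σ y.2.2) • ((B y.2.1 w.2.1 : W →ₗ[ℝ] ℝ).smulRight v.2.1) := by
    ext u
    simp [curvature_univ_apply, hDΓ, hΓy, hBs _ u w.2.1, hBt v.2.1 u]
    module
  have e3 : LinearMap.trace ℝ ℝ (LinearMap.snd ℝ W ℝ ∘ₗ (LinearMap.snd ℝ V (W × ℝ) ∘ₗ
      (curvature (warped c α β A B) univ y v w : V × W × ℝ →ₗ[ℝ] V × W × ℝ) ∘ₗ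
        LinearMap.inr ℝ V (W × ℝ)) ∘ₗ LinearMap.inr ℝ W ℝ) =
      (-ρ' - μ y.2.2 * ρ y.2.2 + κ y.2.2 * ρ y.2.2) * A y.1 v.1 w.1 +
      (-σ' - μ y.2.2 * σ y.2.2 + ν y.2.2 * σ y.2.2) * B y.2.1 v.2.1 w.2.1 := by
    rw [LinearMap.trace_real]
    simp [curvature_univ_apply, hDΓ, hΓy]
    ring
  rw [e1, e2, e3]
  simp only [map_add, map_smul, LinearMap.trace_id, LinearMap.trace_smulRight, smul_eq_mul,
    ← ricci_apply, ContinuousLinearMap.coe_coe]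
  rw [hAs _ w.1, hBs _ w.2.1]
  ring

/-- If `Ric(A) = -(p - 1) A` and `Ric(B) = (q - 1) B` with `p = dim V` and `q = dim W`, then
`r⁻² (dr² + (1 + r²/4)² A + (1 - r²/4)² B)` has Ricci tensor `-(p + q)` times itself. With
`r = 2 e^{-t}` this is the metric `dt² + cosh² t A + sinh² t B`. -/
theorem ricci_warped_poincare [FiniteDimensional ℝ V] [FiniteDimensional ℝ W] {y : V × W × ℝ}
    (hr : y.2.2 ∈ Ioo (0 : ℝ) 2) (hA : ContDiffAt ℝ 2 A y.1) (hB : ContDiffAt ℝ 2 B y.2.1)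
    (hAi : (A y.1).IsInvertible) (hBi : (B y.2.1).IsInvertible)
    (hAs : ∀ z u v, A z u v = A z v u) (hBs : ∀ z u v, B z u v = B z v u)
    (hRA : ∀ v w, ricci A univ y.1 v w = -((Module.finrank ℝ V : ℝ) - 1) * A y.1 v w)
    (hRB : ∀ v w, ricci B univ y.2.1 v w = ((Module.finrank ℝ W : ℝ) - 1) * B y.2.1 v w)
    (v w : V × W × ℝ) :
    ricci (warped (fun r => (r ^ 2)⁻¹) (fun r => (r ^ 2)⁻¹ * (1 + r ^ 2 / 4) ^ 2)
        (fun r => (r ^ 2)⁻¹ * (1 - r ^ 2 / 4) ^ 2) A B) univ y v w =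
      -((Module.finrank ℝ V : ℝ) + Module.finrank ℝ W) *
        warped (fun r => (r ^ 2)⁻¹) (fun r => (r ^ 2)⁻¹ * (1 + r ^ 2 / 4) ^ 2)
          (fun r => (r ^ 2)⁻¹ * (1 - r ^ 2 / 4) ^ 2) A B y v w := by
  have hne : ∀ r ∈ Ioo (0 : ℝ) 2, r ≠ 0 ∧ 4 + r ^ 2 ≠ 0 ∧ 4 - r ^ 2 ≠ 0 := fun r hr =>
    ⟨hr.1.ne', by positivity, by nlinarith [hr.1, hr.2]⟩
  have hnhds : ∀ᶠ r in 𝓝 y.2.2, r ∈ Ioo (0 : ℝ) 2 := Ioo_mem_nhds hr.1 hr.2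
  obtain ⟨h0, hp, hm⟩ := hne _ hr
  set r := y.2.2 with hrdef
  -- The logarithmic derivatives are `κ = -(4 - r²) / (r (4 + r²))`, `ν = -(4 + r²) / (r (4 - r²))`
  -- and `μ = -1 / r`; moreover `ρ = σ = -(16 - r⁴) / (16 r)`.
  have hsq : ∀ r : ℝ, HasDerivAt (fun r : ℝ => r ^ 2) (2 * r) r := fun r => by
    simpa using hasDerivAt_pow 2 r
  have hc' : ∀ r ∈ Ioo (0 : ℝ) 2, HasDerivAt (fun r : ℝ => (r ^ 2)⁻¹)
      (2 * (-1 / r) * (r ^ 2)⁻¹) r := fun r hr => by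
    obtain ⟨h0, -, -⟩ := hne r hr
    refine ((hsq r).fun_inv (pow_ne_zero 2 h0)).congr_deriv ?_
    field_simp
  have hα' : ∀ r ∈ Ioo (0 : ℝ) 2, HasDerivAt (fun r : ℝ => (r ^ 2)⁻¹ * (1 + r ^ 2 / 4) ^ 2)
      (2 * (-(4 - r ^ 2) / (r * (4 + r ^ 2))) * ((r ^ 2)⁻¹ * (1 + r ^ 2 / 4) ^ 2)) r :=
    fun r hr => by
      obtain ⟨h0, hp, -⟩ := hne r hr
      refine ((hc' r hr).fun_mul ((((hsq r).div_const 4).const_add 1).fun_pow 2)).congr_deriv ?_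
      field_simp
      ring
  have hβ' : ∀ r ∈ Ioo (0 : ℝ) 2, HasDerivAt (fun r : ℝ => (r ^ 2)⁻¹ * (1 - r ^ 2 / 4) ^ 2)
      (2 * (-(4 + r ^ 2) / (r * (4 - r ^ 2))) * ((r ^ 2)⁻¹ * (1 - r ^ 2 / 4) ^ 2)) r :=
    fun r hr => by
      obtain ⟨h0, -, hm⟩ := hne r hr
      refine ((hc' r hr).fun_mul ((((hsq r).div_const 4).const_sub 1).fun_pow 2)).congr_deriv ?_
      field_simp
      ring
  -- `κ' + κ² - κ μ = r⁻²` expresses `cosh'' = cosh` in the variable `r`, and the same identity for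
  -- `ν` expresses `sinh'' = sinh`.
  have hκ : HasDerivAt (fun r : ℝ => -(4 - r ^ 2) / (r * (4 + r ^ 2)))
      ((r ^ 2)⁻¹ - (-(4 - r ^ 2) / (r * (4 + r ^ 2))) ^ 2 +
        -(4 - r ^ 2) / (r * (4 + r ^ 2)) * (-1 / r)) r := by
    refine (((hsq r).const_sub 4).fun_neg.fun_div ((hasDerivAt_id' r).fun_mul
      ((hsq r).const_add 4)) (mul_ne_zero h0 hp)).congr_deriv ?_
    field_simp
    ring
  have hν : HasDerivAt (fun r : ℝ => -(4 + r ^ 2) / (r * (4 - r ^ 2)))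
      ((r ^ 2)⁻¹ - (-(4 + r ^ 2) / (r * (4 - r ^ 2))) ^ 2 +
        -(4 + r ^ 2) / (r * (4 - r ^ 2)) * (-1 / r)) r := by
    refine (((hsq r).const_add 4).fun_neg.fun_div ((hasDerivAt_id' r).fun_mul
      ((hsq r).const_sub 4)) (mul_ne_zero h0 hm)).congr_deriv ?_
    field_simp
    ring
  have hμ : HasDerivAt (fun r : ℝ => -1 / r) ((r ^ 2)⁻¹) r := by
    refine ((hasDerivAt_const r (-1 : ℝ)).fun_div (hasDerivAt_id' r) h0).congr_deriv ?_
    field_simp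
    ring
  have hρ : HasDerivAt (fun r : ℝ => -((4 - r ^ 2) * (4 + r ^ 2)) / (16 * r))
      ((r ^ 2)⁻¹ + 3 * r ^ 2 / 16) r := by
    refine ((((hsq r).const_sub 4).fun_mul ((hsq r).const_add 4)).fun_neg.fun_div
      ((hasDerivAt_id' r).const_mul 16) (by simpa using h0)).congr_deriv ?_
    field_simp
    ring
  have hcs : ContDiffAt ℝ 2 (fun r : ℝ => (r ^ 2)⁻¹) r :=
    (contDiffAt_id.pow 2).inv (pow_ne_zero 2 h0)
  have hne1 : (1 : ℝ) + r ^ 2 / 4 ≠ 0 := by positivity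
  have hne2 : (1 : ℝ) - r ^ 2 / 4 ≠ 0 := fun h => hm (by linarith)
  rw [ricci_warped hκ hν hμ hρ hρ (hnhds.mono hc') (hnhds.mono hα') (hnhds.mono hβ')
    (hnhds.mono fun r hr => ?_) (hnhds.mono fun r hr => ?_) hcs (by fun_prop) (by fun_prop)
    (by positivity) (by positivity) (by positivity) hA hB hAi hBi hAs hBs, warped_apply, hRA, hRB,
    ← hrdef]
  · field_simp
    ring
  · obtain ⟨h0, hp, hm⟩ := hne r hr
    field_simp
    ring
  · obtain ⟨h0, hp, hm⟩ := hne r hr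
    field_simp
    ring

end Coord

/-! ### Fields of bilinear forms in charts -/

section Charts

variable {E : Type*} [NormedAddCommGroup E] [NormedSpace ℝ E]
  {H : Type*} [TopologicalSpace H] {I : ModelWithCorners ℝ E H}
  {M : Type*} [TopologicalSpace M] [ChartedSpace H M]
  {E' : Type*} [NormedAddCommGroup E'] [NormedSpace ℝ E']
  {H' : Type*} [TopologicalSpace H'] {I' : ModelWithCorners ℝ E' H'}
  {M' : Type*} [TopologicalSpace M'] [ChartedSpace H' M']
  {E'' : Type*} [NormedAddCommGroup E''] [NormedSpace ℝ E'']
  {H'' : Type*} [TopologicalSpace H''] {I'' : ModelWithCorners ℝ E'' H''}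
  {M'' : Type*} [TopologicalSpace M''] [ChartedSpace H'' M'']

theorem pullback_apply (f : M → M') (g : BilinField I' M') (x : M) (u v : TangentSpace I x) :
    pullback I I' f g x u v = g (f x) (mfderiv I I' f x u) (mfderiv I I' f x v) := rfl

theorem diffSq_apply (f : M → ℝ) (x : M) (u v : TangentSpace I x) :
    diffSq I f x u v =
      ContinuousLinearMap.mul ℝ ℝ (mfderiv I 𝓘(ℝ, ℝ) f x u) (mfderiv I 𝓘(ℝ, ℝ) f x v) := rfl

theorem pullback_comp {f : M → M'} {h : M' → M''} (g : BilinField I'' M'') {x : M}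
    (hh : MDifferentiableAt I' I'' h (f x)) (hf : MDifferentiableAt I I' f x) :
    pullback I I' f (pullback I' I'' h g) x = pullback I I'' (h ∘ f) g x := by
  ext u v
  rw [pullback_apply, pullback_apply, pullback_apply, mfderiv_comp x hh hf]
  rfl

theorem chartMetric_apply (g : BilinField I M) (x : M) (y u v : E) :
    chartMetric I g x y u v = g ((extChartAt I x).symm y)
      (mfderivWithin 𝓘(ℝ, E) I (extChartAt I x).symm (range I) y u)
      (mfderivWithin 𝓘(ℝ, E) I (extChartAt I x).symm (range I) y v) := rfl

/-- At the centre of the chart, the chart expression of a field of bilinear forms is its value,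
as the tangent space is identified with the model space through that chart. -/
theorem chartMetric_self [IsManifold I 1 M] (g : BilinField I M) (x : M) :
    chartMetric I g x (extChartAt I x x) = g x := by
  ext u v
  rw [chartMetric_apply, mfderivWithin_range_extChartAt_symm, extChartAt_to_inv]
  rfl

theorem chartMetric_symm {g : BilinField I M} (hg : ∀ x (u v : TangentSpace I x), g x u v = g x v u)
    (x : M) (y u v : E) : chartMetric I g x y u v = chartMetric I g x y v u := by
  rw [chartMetric_apply, chartMetric_apply]
  exact hg _ _ _

/-- Chart expressions of a pullback: if `f̂` is the expression of `f` in charts, the expression of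
`f^* g` is the pullback under `f̂` of the expression of `g`. -/
theorem chartMetric_pullback [IsManifold I 1 M] [IsManifold I' 1 M'] {f : M → M'}
    (g : BilinField I' M') {x : M} {y : E} (hy : y ∈ (extChartAt I x).target)
    (hf : MDifferentiableAt I I' f ((extChartAt I x).symm y))
    (hfy : f ((extChartAt I x).symm y) ∈ (extChartAt I' (f x)).source) :
    chartMetric I (pullback I I' f g) x y =
      (chartMetric I' g (f x) (writtenInExtChartAt I I' x f y)).bilinearComp
        (fderivWithin ℝ (writtenInExtChartAt I I' x f) (range I) y)
        (fderivWithin ℝ (writtenInExtChartAt I I' x f) (range I) y) := by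
  have hu : UniqueMDiffWithinAt 𝓘(ℝ, E) (range I) y :=
    (I.uniqueDiffOn _ (extChartAt_target_subset_range x hy)).uniqueMDiffWithinAt
  have hφ := mdifferentiableWithinAt_extChartAt_symm hy
  have hψ : MDifferentiableWithinAt 𝓘(ℝ, E') I' (extChartAt I' (f x)).symm (range I')
      (writtenInExtChartAt I I' x f y) :=
    mdifferentiableWithinAt_extChartAt_symm ((extChartAt I' (f x)).map_source hfy)
  have h1 : MDifferentiableWithinAt 𝓘(ℝ, E) I' (f ∘ (extChartAt I x).symm) (range I) y :=
    hf.comp_mdifferentiableWithinAt y hφ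
  have h2 : MDifferentiableWithinAt 𝓘(ℝ, E) 𝓘(ℝ, E') (writtenInExtChartAt I I' x f) (range I) y :=
    (mdifferentiableAt_extChartAt (by simpa using hfy)).comp_mdifferentiableWithinAt y h1
  have hmaps : MapsTo (writtenInExtChartAt I I' x f) (range I) (range I') :=
    fun z _ => by simp [writtenInExtChartAt, extChartAt]
  have key : (mfderiv I I' f ((extChartAt I x).symm y)).comp
      (mfderivWithin 𝓘(ℝ, E) I (extChartAt I x).symm (range I) y) =
      (mfderivWithin 𝓘(ℝ, E') I' (extChartAt I' (f x)).symm (range I')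
        (writtenInExtChartAt I I' x f y)).comp
      (mfderivWithin 𝓘(ℝ, E) 𝓘(ℝ, E') (writtenInExtChartAt I I' x f) (range I) y) := by
    have heq : f ∘ (extChartAt I x).symm =ᶠ[𝓝[range I] y]
        (extChartAt I' (f x)).symm ∘ writtenInExtChartAt I I' x f := by
      filter_upwards [h1.continuousWithinAt.preimage_mem_nhdsWithin
        ((isOpen_extChartAt_source (f x)).mem_nhds hfy)] with z hz
      exact ((extChartAt I' (f x)).left_inv hz).symm
    rw [← mfderiv_comp_mfderivWithin y hf hφ hu, ← mfderivWithin_comp y hψ h2 hmaps hu]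
    exact heq.mfderivWithin_eq (heq.eq_of_nhdsWithin (extChartAt_target_subset_range x hy))
  have hpt : (extChartAt I' (f x)).symm (writtenInExtChartAt I I' x f y) =
      f ((extChartAt I x).symm y) := (extChartAt I' (f x)).left_inv hfy
  rw [mfderivWithin_eq_fderivWithin] at key
  have hk : ∀ u : E, (mfderiv I I' f ((extChartAt I x).symm y) : E →L[ℝ] E')
      ((mfderivWithin 𝓘(ℝ, E) I (extChartAt I x).symm (range I) y : E →L[ℝ] E) u) =
      (mfderivWithin 𝓘(ℝ, E') I' (extChartAt I' (f x)).symm (range I')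
        (writtenInExtChartAt I I' x f y) : E' →L[ℝ] E')
        (fderivWithin ℝ (writtenInExtChartAt I I' x f) (range I) y u) :=
    fun u => congrArg (fun L : E →L[ℝ] E' => L u) key
  have hcongr : ∀ {q q' : M'} {a a' c c' : E'}, q = q' → a = a' → c = c' →
      (g q : E' →L[ℝ] E' →L[ℝ] ℝ) a c = (g q' : E' →L[ℝ] E' →L[ℝ] ℝ) a' c' := by
    rintro q _ a _ c _ rfl rfl rfl
    rfl
  ext u v
  exact hcongr hpt.symm (hk u) (hk v)

/-- A field of bilinear forms is smooth at a point, as a section of the bundle of bilinear forms on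
the tangent bundle, if and only if its chart expression is: on the domain of the chart that
expression is the section in the trivialization of the bundle. -/
theorem contMDiffAt_iff_chartMetric [IsManifold I ∞ M] (g : BilinField I M) (x : M) :
    ContMDiffAt I (I.prod 𝓘(ℝ, E →L[ℝ] E →L[ℝ] ℝ)) ∞
      (fun x : M => TotalSpace.mk' (E →L[ℝ] E →L[ℝ] ℝ)
        (E := fun x : M => TangentSpace I x →L[ℝ] TangentSpace I x →L[ℝ] ℝ) x (g x)) x ↔
      ContDiffWithinAt ℝ ∞ (chartMetric I g x) (range I) (extChartAt I x x) := by
  rw [Bundle.contMDiffAt_section]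
  have h : (fun z => (trivializationAt (E →L[ℝ] E →L[ℝ] ℝ)
      (fun x : M => TangentSpace I x →L[ℝ] TangentSpace I x →L[ℝ] ℝ) x ⟨z, g z⟩).2) =ᶠ[𝓝 x]
      fun z => chartMetric I g x (extChartAt I x z) := by
    filter_upwards [extChartAt_source_mem_nhds (I := I) x] with z hz
    have hz' : z ∈ (chartAt H x).source := by simpa using hz
    ext u v
    rw [chartMetric_apply, ← TangentBundle.symmL_trivializationAt hz', (extChartAt I x).left_inv hz]
    have hb : z ∈ (trivializationAt (E →L[ℝ] ℝ)
        (fun x : M => TangentSpace I x →L[ℝ] ℝ) x).baseSet := by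
      simpa [hom_trivializationAt_baseSet] using hz'
    simp [hom_trivializationAt_apply, ContinuousLinearMap.inCoordinates,
      Trivialization.coe_linearMapAt_of_mem _ hb]
    rfl
  rw [h.contMDiffAt_iff, contMDiffAt_iff]
  have h' : (fun z => chartMetric I g x (extChartAt I x z)) ∘ (extChartAt I x).symm
      =ᶠ[𝓝[range I] (extChartAt I x x)] chartMetric I g x := by
    filter_upwards [extChartAt_target_mem_nhdsWithin x] with y hy
    change chartMetric I g x (extChartAt I x ((extChartAt I x).symm y)) = _
    rw [(extChartAt I x).right_inv hy]
  have hx : extChartAt I x x ∈ range I := mem_range_self _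
  simp only [extChartAt_model_space_eq_id, PartialEquiv.refl_coe, Function.id_comp]
  refine ⟨fun h => h.2.congr_of_eventuallyEq_of_mem h'.symm hx,
    fun h => ⟨?_, h.congr_of_eventuallyEq_of_mem h' hx⟩⟩
  exact Filter.Tendsto.comp (g := chartMetric I g x) h.continuousWithinAt
    (tendsto_nhdsWithin_iff.2 ⟨continuousAt_extChartAt x,
      Filter.Eventually.of_forall fun z => mem_range_self _⟩)

end Charts

/-! ### Smoothness and nondegeneracy of pullbacks and products -/

section PseudoRiemannian

variable {E : Type*} [NormedAddCommGroup E] [NormedSpace ℝ E]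
  {H : Type*} [TopologicalSpace H] {I : ModelWithCorners ℝ E H}
  {M : Type*} [TopologicalSpace M] [ChartedSpace H M]
  {E' : Type*} [NormedAddCommGroup E'] [NormedSpace ℝ E']
  {H' : Type*} [TopologicalSpace H'] {I' : ModelWithCorners ℝ E' H'}
  {M' : Type*} [TopologicalSpace M'] [ChartedSpace H' M']
  {E'' : Type*} [NormedAddCommGroup E''] [NormedSpace ℝ E'']
  {H'' : Type*} [TopologicalSpace H''] {I'' : ModelWithCorners ℝ E'' H''}
  {M'' : Type*} [TopologicalSpace M''] [ChartedSpace H'' M'']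

/-- Smoothness of a field of bilinear forms, as a section of the bundle of bilinear forms on the
tangent bundle. -/
def IsSmoothField [IsManifold I ∞ M] (g : BilinField I M) : Prop :=
  ContMDiff I (I.prod 𝓘(ℝ, E →L[ℝ] E →L[ℝ] ℝ)) ∞
    (fun x : M => TotalSpace.mk' (E →L[ℝ] E →L[ℝ] ℝ)
      (E := fun x : M => TangentSpace I x →L[ℝ] TangentSpace I x →L[ℝ] ℝ) x (g x))

theorem isSmoothField_iff [IsManifold I ∞ M] {g : BilinField I M} : IsSmoothField g ↔
    ∀ x, ContDiffWithinAt ℝ ∞ (chartMetric I g x) (range I) (extChartAt I x x) :=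
  forall_congr' fun x => contMDiffAt_iff_chartMetric g x

theorem IsSmoothField.add [IsManifold I ∞ M] {g h : BilinField I M} (hg : IsSmoothField g)
    (hh : IsSmoothField h) : IsSmoothField (fun x => g x + h x) :=
  ContMDiff.add_section hg hh

theorem IsSmoothField.smul [IsManifold I ∞ M] {g : BilinField I M} {f : M → ℝ}
    (hf : ContMDiff I 𝓘(ℝ, ℝ) ∞ f) (hg : IsSmoothField g) : IsSmoothField (fun x => f x • g x) :=
  ContMDiff.smul_section hf hg

theorem IsSmoothField.pullback [IsManifold I ∞ M] [IsManifold I' ∞ M'] {g : BilinField I' M'}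
    {f : M → M'} (hf : ContMDiff I I' ∞ f) (hg : IsSmoothField g) :
    IsSmoothField (pullback I I' f g) := by
  rw [isSmoothField_iff] at hg ⊢
  intro x
  have hx : extChartAt I x x ∈ range I := mem_range_self _
  have hw : ContDiffWithinAt ℝ ∞ (writtenInExtChartAt I I' x f) (range I) (extChartAt I x x) :=
    (contMDiffAt_iff.1 (hf x)).2
  have hD := hw.fderivWithin_right I.uniqueDiffOn (m := ∞) (by simp) hx
  have hmaps : MapsTo (writtenInExtChartAt I I' x f) (range I) (range I') :=
    fun z _ => by simp [writtenInExtChartAt, extChartAt]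
  have hval : writtenInExtChartAt I I' x f (extChartAt I x x) = extChartAt I' (f x) (f x) := by
    simp only [writtenInExtChartAt, Function.comp_apply, extChartAt_to_inv]
  have hg' : ContDiffWithinAt ℝ ∞ (fun y => chartMetric I' g (f x) (writtenInExtChartAt I I' x f y))
      (range I) (extChartAt I x x) :=
    ContDiffWithinAt.comp (g := chartMetric I' g (f x)) (t := range I') _ (hval ▸ hg (f x)) hw hmaps
  refine (hg'.bilinearComp hD hD).congr_of_eventuallyEq_of_mem ?_ hx
  have hc : ContinuousWithinAt (f ∘ (extChartAt I x).symm) (range I) (extChartAt I x x) :=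
    (hf.continuous.continuousAt.comp (continuousAt_extChartAt_symm x)).continuousWithinAt
  have hs : (extChartAt I' (f x)).source ∈ 𝓝 ((f ∘ (extChartAt I x).symm) (extChartAt I x x)) := by
    simpa only [Function.comp_apply, extChartAt_to_inv] using
      extChartAt_source_mem_nhds (I := I') (f x)
  filter_upwards [extChartAt_target_mem_nhdsWithin x, hc.preimage_mem_nhdsWithin hs] with y hy hy'
  exact chartMetric_pullback g hy (hf.mdifferentiableAt (by simp)) hy'

theorem chartMetric_mul (x : ℝ) :
    chartMetric 𝓘(ℝ, ℝ) (fun _ : ℝ => ContinuousLinearMap.mul ℝ ℝ) x =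
      fun _ => ContinuousLinearMap.mul ℝ ℝ := by
  funext y
  have hD : (mfderivWithin 𝓘(ℝ, ℝ) 𝓘(ℝ, ℝ) (extChartAt 𝓘(ℝ, ℝ) x).symm (range 𝓘(ℝ, ℝ)) y :
      ℝ →L[ℝ] ℝ) = ContinuousLinearMap.id ℝ ℝ := by
    rw [mfderivWithin_eq_fderivWithin]
    simpa using! fderiv_id
  refine ContinuousLinearMap.ext fun u => ContinuousLinearMap.ext fun v => ?_
  change ContinuousLinearMap.mul ℝ ℝ
    ((mfderivWithin 𝓘(ℝ, ℝ) 𝓘(ℝ, ℝ) (extChartAt 𝓘(ℝ, ℝ) x).symm (range 𝓘(ℝ, ℝ)) y :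
      ℝ →L[ℝ] ℝ) u)
    ((mfderivWithin 𝓘(ℝ, ℝ) 𝓘(ℝ, ℝ) (extChartAt 𝓘(ℝ, ℝ) x).symm (range 𝓘(ℝ, ℝ)) y :
      ℝ →L[ℝ] ℝ) v) = _
  rw [hD]
  rfl

theorem isSmoothField_diffSq [IsManifold I ∞ M] {f : M → ℝ} (hf : ContMDiff I 𝓘(ℝ, ℝ) ∞ f) :
    IsSmoothField (diffSq I f) :=
  IsSmoothField.pullback hf (isSmoothField_iff.2 fun x => by
    rw [chartMetric_mul]
    exact contDiffWithinAt_const)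

theorem IsPseudoRiemannian.smul [IsManifold I ∞ M] {g : BilinField I M} {f : M → ℝ}
    (hg : IsPseudoRiemannian I g) (hf : ContMDiff I 𝓘(ℝ, ℝ) ∞ f) (hf0 : ∀ x, f x ≠ 0) :
    IsPseudoRiemannian I (fun x => f x • g x) where
  symm x u v := congrArg (f x * ·) (hg.symm x u v)
  nondegenerate x u hu := hg.nondegenerate x u fun v =>
    (mul_eq_zero.1 (hu v)).resolve_left (hf0 x)
  contMDiff := IsSmoothField.smul hf hg.contMDiff

/-- The value of a field of bilinear forms at a point, as a form on the model vector space, to which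
each tangent space is equal by definition. -/
def formAt (g : BilinField I M) (x : M) : E →L[ℝ] E →L[ℝ] ℝ := g x

variable (I I') in
/-- The differential of a map at a point, as a map of model vector spaces. -/
noncomputable def diffAt (f : M → M') (x : M) : E →L[ℝ] E' := mfderiv I I' f x

theorem formAt_pullback (f : M → M') (g : BilinField I' M') (x : M) (u v : E) :
    formAt (pullback I I' f g) x u v = formAt g (f x) (diffAt I I' f x u) (diffAt I I' f x v) := rfl

theorem formAt_diffSq (f : M → ℝ) (x : M) (u v : E) :
    formAt (diffSq I f) x u v = diffAt I 𝓘(ℝ, ℝ) f x u * diffAt I 𝓘(ℝ, ℝ) f x v := rfl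

theorem isPseudoRiemannian_iff [IsManifold I ∞ M] {g : BilinField I M} :
    IsPseudoRiemannian I g ↔ (∀ x u v, formAt g x u v = formAt g x v u) ∧
      (∀ x u, (∀ v, formAt g x u v = 0) → u = 0) ∧ IsSmoothField g :=
  ⟨fun h => ⟨h.symm, h.nondegenerate, h.contMDiff⟩, fun h => ⟨h.1, h.2.1, h.2.2⟩⟩

theorem diffAt_fst (x : M × M') :
    diffAt (I.prod I') I (Prod.fst : M × M' → M) x = ContinuousLinearMap.fst ℝ E E' :=
  mfderiv_fst

theorem diffAt_snd (x : M × M') :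
    diffAt (I.prod I') I' (Prod.snd : M × M' → M') x = ContinuousLinearMap.snd ℝ E E' :=
  mfderiv_snd

theorem diffAt_comp {f : M → M'} {h : M' → M''} {x : M}
    (hh : MDifferentiableAt I' I'' h (f x)) (hf : MDifferentiableAt I I' f x) :
    diffAt I I'' (fun x => h (f x)) x = (diffAt I' I'' h (f x)).comp (diffAt I I' f x) :=
  mfderiv_comp x hh hf

theorem formAt_prodMetric (g : BilinField I M)
    (g' : BilinField I' M') (x : M × M') (u v : E × E') :
    formAt (prodMetric I I' g g') x u v = formAt g x.1 u.1 v.1 + formAt g' x.2 u.2 v.2 := by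
  change formAt (pullback (I.prod I') I Prod.fst g) x u v +
    formAt (pullback (I.prod I') I' Prod.snd g') x u v = _
  rw [formAt_pullback, formAt_pullback, diffAt_fst, diffAt_snd]
  rfl

theorem IsPseudoRiemannian.prodMetric [IsManifold I ∞ M] [IsManifold I' ∞ M']
    {g : BilinField I M} {g' : BilinField I' M'} (hg : IsPseudoRiemannian I g)
    (hg' : IsPseudoRiemannian I' g') :
    IsPseudoRiemannian (I.prod I') (_root_.prodMetric I I' g g') := by
  rw [isPseudoRiemannian_iff] at *
  refine ⟨fun x u v => ?_, fun x u hu => ?_, ?_⟩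
  · rw [formAt_prodMetric, formAt_prodMetric, hg.1, hg'.1]
  · simp only [formAt_prodMetric] at hu
    exact Prod.ext (hg.2.1 x.1 _ fun v => by simpa using hu (v, 0))
      (hg'.2.1 x.2 _ fun v => by simpa using hu (0, v))
  · exact (IsSmoothField.pullback contMDiff_fst hg.2.2).add
      (IsSmoothField.pullback contMDiff_snd hg'.2.2)

/-- The field `dr² + a g + b g'` on a triple product `M × M' × M''`, where `r` is a function on the
third factor and `a`, `b` are functions of `r`. -/
noncomputable def threefoldMetric (a b : ℝ → ℝ) (r : M'' → ℝ) (g : BilinField I M)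
    (g' : BilinField I' M') : BilinField (I.prod (I'.prod I'')) (M × M' × M'') := fun x =>
  diffSq (I.prod (I'.prod I'')) (fun x : M × M' × M'' => r x.2.2) x +
    a (r x.2.2) • pullback (I.prod (I'.prod I'')) I (fun x : M × M' × M'' => x.1) g x +
    b (r x.2.2) • pullback (I.prod (I'.prod I'')) I' (fun x : M × M' × M'' => x.2.1) g' x

theorem diffAt_snd_fst (x : M × M' × M'') :
    diffAt (I.prod (I'.prod I'')) I' (fun x : M × M' × M'' => x.2.1) x =
      (ContinuousLinearMap.fst ℝ E' E'').comp (ContinuousLinearMap.snd ℝ E (E' × E'')) := by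
  rw [diffAt_comp (I' := I'.prod I'') (f := (Prod.snd : M × M' × M'' → M' × M''))
    (h := (Prod.fst : M' × M'' → M')) mdifferentiableAt_fst mdifferentiableAt_snd, diffAt_fst,
    diffAt_snd]

theorem diffAt_snd_snd (x : M × M' × M'') :
    diffAt (I.prod (I'.prod I'')) I'' (fun x : M × M' × M'' => x.2.2) x =
      (ContinuousLinearMap.snd ℝ E' E'').comp (ContinuousLinearMap.snd ℝ E (E' × E'')) := by
  rw [diffAt_comp (I' := I'.prod I'') (f := (Prod.snd : M × M' × M'' → M' × M''))
    (h := (Prod.snd : M' × M'' → M'')) mdifferentiableAt_snd mdifferentiableAt_snd, diffAt_snd,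
    diffAt_snd]

theorem diffAt_apply_snd_snd {r : M'' → ℝ} (x : M × M' × M'')
    (hr : MDifferentiableAt I'' 𝓘(ℝ, ℝ) r x.2.2) (u : E × E' × E'') :
    diffAt (I.prod (I'.prod I'')) 𝓘(ℝ, ℝ) (fun x : M × M' × M'' => r x.2.2) x u =
      diffAt I'' 𝓘(ℝ, ℝ) r x.2.2 u.2.2 := by
  rw [diffAt_comp (I' := I'') (f := fun x : M × M' × M'' => x.2.2) hr
    (mdifferentiableAt_snd.comp x mdifferentiableAt_snd), diffAt_snd_snd]
  rfl

theorem formAt_threefoldMetric {a b : ℝ → ℝ} {r : M'' → ℝ} (g : BilinField I M)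
    (g' : BilinField I' M') (x : M × M' × M'') (hr : MDifferentiableAt I'' 𝓘(ℝ, ℝ) r x.2.2)
    (u v : E × E' × E'') :
    formAt (threefoldMetric (I'' := I'') a b r g g') x u v =
      diffAt I'' 𝓘(ℝ, ℝ) r x.2.2 u.2.2 * diffAt I'' 𝓘(ℝ, ℝ) r x.2.2 v.2.2 +
      a (r x.2.2) * formAt g x.1 u.1 v.1 + b (r x.2.2) * formAt g' x.2.1 u.2.1 v.2.1 := by
  change formAt (diffSq (I.prod (I'.prod I'')) (fun x : M × M' × M'' => r x.2.2)) x u v +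
    a (r x.2.2) * formAt (pullback (I.prod (I'.prod I'')) I Prod.fst g) x u v +
    b (r x.2.2) * formAt (pullback (I.prod (I'.prod I'')) I'
      (fun x : M × M' × M'' => x.2.1) g') x u v = _
  rw [formAt_diffSq, formAt_pullback, formAt_pullback, diffAt_apply_snd_snd x hr,
    diffAt_apply_snd_snd x hr, diffAt_snd_fst, diffAt_fst]
  rfl

theorem isPseudoRiemannian_threefoldMetric [IsManifold I ∞ M] [IsManifold I' ∞ M']
    [IsManifold I'' ∞ M''] {a b : ℝ → ℝ} {r : M'' → ℝ} {g : BilinField I M}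
    {g' : BilinField I' M'} (hg : IsPseudoRiemannian I g) (hg' : IsPseudoRiemannian I' g')
    (ha : ContDiff ℝ ∞ a) (hb : ContDiff ℝ ∞ b) (hr : ContMDiff I'' 𝓘(ℝ, ℝ) ∞ r)
    (ha0 : ∀ t, a (r t) ≠ 0) (hb0 : ∀ t, b (r t) ≠ 0)
    (hr' : ∀ t, Function.Injective (diffAt I'' 𝓘(ℝ, ℝ) r t)) :
    IsPseudoRiemannian (I.prod (I'.prod I'')) (threefoldMetric (I'' := I'') a b r g g') := by
  rw [isPseudoRiemannian_iff] at *
  have hd : ∀ t, MDifferentiableAt I'' 𝓘(ℝ, ℝ) r t := fun t => hr.mdifferentiableAt (by simp)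
  refine ⟨fun x u v => ?_, fun x u hu => ?_, ?_⟩
  · rw [formAt_threefoldMetric _ _ _ (hd _), formAt_threefoldMetric _ _ _ (hd _), hg.1, hg'.1,
      mul_comm (diffAt _ _ _ _ _)]
  · simp only [formAt_threefoldMetric _ _ _ (hd _)] at hu
    refine Prod.ext (hg.2.1 x.1 _ fun v => ?_) (Prod.ext (hg'.2.1 x.2.1 _ fun v => ?_)
      (hr' x.2.2 ?_))
    · simpa [ha0] using hu (v, 0, 0)
    · simpa [hb0] using hu (0, v, 0)
    · simpa using hu (0, 0, u.2.2)
  · have h3 : ContMDiff (I.prod (I'.prod I'')) 𝓘(ℝ, ℝ) ∞ (fun x : M × M' × M'' => r x.2.2) :=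
      hr.comp (contMDiff_snd.comp contMDiff_snd)
    exact ((isSmoothField_diffSq h3).add (IsSmoothField.smul (ha.contMDiff.comp h3)
      (IsSmoothField.pullback contMDiff_fst hg.2.2))).add
      (IsSmoothField.smul (hb.contMDiff.comp h3)
        (IsSmoothField.pullback (contMDiff_fst.comp contMDiff_snd) hg'.2.2))

end PseudoRiemannian

/-! ### The Einstein equation on the interior -/

section Einstein

variable {E : Type*} [NormedAddCommGroup E] [NormedSpace ℝ E]
  {H : Type*} [TopologicalSpace H] {I : ModelWithCorners ℝ E H}
  {M : Type*} [TopologicalSpace M] [ChartedSpace H M]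
  {E' : Type*} [NormedAddCommGroup E'] [NormedSpace ℝ E']
  {H' : Type*} [TopologicalSpace H'] {I' : ModelWithCorners ℝ E' H'}
  {M' : Type*} [TopologicalSpace M'] [ChartedSpace H' M']

/-- The chart expression of the pullback under a map `f` that is a linear map `L` in charts. -/
theorem chartMetric_pullback_of_linear [IsManifold I 1 M] [IsManifold I' 1 M'] {f : M → M'}
    (g : BilinField I' M') {x : M} (hf : MDifferentiable I I' f) (L : E →L[ℝ] E')
    (hs : ∀ z ∈ (extChartAt I x).source, f z ∈ (extChartAt I' (f x)).source)
    (hL : ∀ z ∈ (extChartAt I x).source, extChartAt I' (f x) (f z) = L (extChartAt I x z))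
    {y : E} (hy : y ∈ (extChartAt I x).target) :
    chartMetric I (pullback I I' f g) x y =
      (chartMetric I' g (f x) (L y)).bilinearComp L L := by
  have hw : ∀ z ∈ (extChartAt I x).target, writtenInExtChartAt I I' x f z = L z := fun z hz => by
    rw [writtenInExtChartAt, Function.comp_apply, Function.comp_apply,
      hL _ ((extChartAt I x).map_target hz), (extChartAt I x).right_inv hz]
  have hyr := extChartAt_target_subset_range x hy
  have hD : fderivWithin ℝ (writtenInExtChartAt I I' x f) (range I) y = L := by
    rw [Filter.EventuallyEq.fderivWithin_eq (f := L)
      (Filter.eventually_of_mem (extChartAt_target_mem_nhdsWithin_of_mem hy) hw) (hw y hy)]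
    exact L.hasFDerivWithinAt.fderivWithin (I.uniqueDiffOn y hyr)
  rw [chartMetric_pullback g hy hf.mdifferentiableAt (hs _ ((extChartAt I x).map_target hy)), hD,
    hw y hy]

theorem isInvertible_chartMetric_self [FiniteDimensional ℝ E] [IsManifold I ∞ M]
    {g : BilinField I M} (hg : IsPseudoRiemannian I g) (x : M) :
    (chartMetric I g x (extChartAt I x x)).IsInvertible :=
  isInvertible_of_nondegenerate _ fun u hu => by
    rw [chartMetric_self] at hu
    exact hg.nondegenerate x u hu

/-- The constant of an Einstein metric is the scalar curvature divided by the dimension. -/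
theorem hasEinsteinConstant_of_scalarCurvature [FiniteDimensional ℝ E] [IsManifold I ∞ M]
    {g : BilinField I M} {c : ℝ} (hg : IsEinstein I g) (hdim : Module.finrank ℝ E ≠ 0)
    (hsc : ∀ x, scalarCurvature I g x = Module.finrank ℝ E * c) : HasEinsteinConstant I g c := by
  obtain ⟨hg, c', hc'⟩ := hg
  intro x u v
  have h : scalarCurvature I g x = c' * Module.finrank ℝ E :=
    Coord.scalar_eq_of_ricci_eq (isInvertible_chartMetric_self hg x) fun u v => by
      rw [chartMetric_self]
      exact hc' x u v
  rw [hsc, mul_comm] at h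
  rw [hc', mul_right_cancel₀ (by exact_mod_cast hdim) h]

theorem extChartAt_openInterval (t s : MetricManifold.openInterval) :
    extChartAt 𝓘(ℝ, ℝ) t s = (s : ℝ) := by
  simp [extChartAt]
  rfl

/-- The sub-product metric `r⁻² (dr² + (1 + r²/4)² g + (1 - r²/4)² g')` on `M × M' × (0, 2)`. -/
noncomputable def subProductMetric (g : BilinField I M) (g' : BilinField I' M') :
    BilinField (I.prod (I'.prod 𝓘(ℝ, ℝ))) (M × M' × MetricManifold.openInterval) := fun x =>
  ((x.2.2 : ℝ) ^ 2)⁻¹ • threefoldMetric (I'' := 𝓘(ℝ, ℝ)) (fun r => (1 + r ^ 2 / 4) ^ 2)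
    (fun r => (1 - r ^ 2 / 4) ^ 2) (fun t : MetricManifold.openInterval => (t : ℝ)) g g' x

theorem contMDiff_openInterval_val {n : WithTop ℕ∞} :
    ContMDiff 𝓘(ℝ, ℝ) 𝓘(ℝ, ℝ) n (fun t : MetricManifold.openInterval => (t : ℝ)) :=
  contMDiff_subtype_val

/-- In product charts, the sub-product metric is a doubly warped product of the chart expressions
of the factors. -/
theorem chartMetric_subProductMetric [IsManifold I ∞ M] [IsManifold I' ∞ M']
    (g : BilinField I M) (g' : BilinField I' M') (x : M × M' × MetricManifold.openInterval)
    {y : E × E' × ℝ} (hy : y ∈ (extChartAt (I.prod (I'.prod 𝓘(ℝ, ℝ))) x).target) :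
    chartMetric (I.prod (I'.prod 𝓘(ℝ, ℝ))) (subProductMetric g g') x y =
      Coord.warped (fun r => (r ^ 2)⁻¹) (fun r => (r ^ 2)⁻¹ * (1 + r ^ 2 / 4) ^ 2)
        (fun r => (r ^ 2)⁻¹ * (1 - r ^ 2 / 4) ^ 2) (chartMetric I g x.1)
        (chartMetric I' g' x.2.1) y := by
  set J := I.prod (I'.prod 𝓘(ℝ, ℝ))
  have hφ : ∀ z : M × M' × MetricManifold.openInterval, extChartAt J x z =
      (extChartAt I x.1 z.1, extChartAt I' x.2.1 z.2.1, (z.2.2 : ℝ)) := fun z => by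
    simp only [J, extChartAt_prod, PartialEquiv.prod_coe, extChartAt_openInterval]
  have hsrc : ∀ z ∈ (extChartAt J x).source,
      z.1 ∈ (extChartAt I x.1).source ∧ z.2.1 ∈ (extChartAt I' x.2.1).source := fun z hz => by
    simp only [J, extChartAt_prod, PartialEquiv.prod_source, mem_prod] at hz
    exact ⟨hz.1, hz.2.1⟩
  have h1 := chartMetric_pullback_of_linear (I := J) (f := fun z => z.1) (x := x) g
    mdifferentiable_fst (ContinuousLinearMap.fst ℝ E (E' × ℝ)) (fun z hz => (hsrc z hz).1)
    (fun z hz => by rw [hφ]; rfl) hy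
  have h2 := chartMetric_pullback_of_linear (I := J) (f := fun z => z.2.1) (x := x) g'
    (mdifferentiable_fst.comp mdifferentiable_snd)
    ((ContinuousLinearMap.fst ℝ E' ℝ).comp (ContinuousLinearMap.snd ℝ E (E' × ℝ)))
    (fun z hz => (hsrc z hz).2) (fun z hz => by rw [hφ]; rfl) hy
  have h3 := chartMetric_pullback_of_linear (I := J) (I' := 𝓘(ℝ, ℝ)) (f := fun z => (z.2.2 : ℝ))
    (x := x) (fun _ => ContinuousLinearMap.mul ℝ ℝ)
    ((contMDiff_openInterval_val.mdifferentiable (n := 1) (by simp)).comp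
      (mdifferentiable_snd.comp mdifferentiable_snd))
    ((ContinuousLinearMap.snd ℝ E' ℝ).comp (ContinuousLinearMap.snd ℝ E (E' × ℝ)))
    (fun z hz => by rw [extChartAt_model_space_eq_id]; trivial)
    (fun z hz => by rw [hφ]; rfl) hy
  have hr : ((((extChartAt J x).symm y).2.2 : MetricManifold.openInterval) : ℝ) = y.2.2 := by
    have h := (hφ ((extChartAt J x).symm y)).symm.trans ((extChartAt J x).right_inv hy)
    exact congrArg (fun p : E × E' × ℝ => p.2.2) h
  rw [chartMetric_mul] at h3
  refine ContinuousLinearMap.ext fun u => ContinuousLinearMap.ext fun v => ?_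
  have hsum : chartMetric J (subProductMetric g g') x y u v =
      ((((extChartAt J x).symm y).2.2 : ℝ) ^ 2)⁻¹ *
        (chartMetric J (pullback J 𝓘(ℝ, ℝ)
          (fun z : M × M' × MetricManifold.openInterval => (z.2.2 : ℝ))
          (fun _ => ContinuousLinearMap.mul ℝ ℝ)) x y u v +
        (1 + (((extChartAt J x).symm y).2.2 : ℝ) ^ 2 / 4) ^ 2 *
          chartMetric J (pullback J I (fun z => z.1) g) x y u v +
        (1 - (((extChartAt J x).symm y).2.2 : ℝ) ^ 2 / 4) ^ 2 *
          chartMetric J (pullback J I' (fun z => z.2.1) g') x y u v) := rfl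
  rw [hsum, h1, h2, h3, hr, Coord.warped_apply]
  simp only [ContinuousLinearMap.bilinearComp_apply, ContinuousLinearMap.mul_apply',
    ContinuousLinearMap.comp_apply, ContinuousLinearMap.coe_fst', ContinuousLinearMap.coe_snd']
  ring

theorem diffAt_openInterval_val (t : MetricManifold.openInterval) :
    diffAt 𝓘(ℝ, ℝ) 𝓘(ℝ, ℝ) (fun t : MetricManifold.openInterval => (t : ℝ)) t =
      ContinuousLinearMap.id ℝ ℝ := by
  have h : HasMFDerivAt 𝓘(ℝ, ℝ) 𝓘(ℝ, ℝ) (fun t : MetricManifold.openInterval => (t : ℝ)) t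
      (ContinuousLinearMap.id ℝ ℝ) := by
    refine ⟨continuousAt_subtype_val, ?_⟩
    have heq : writtenInExtChartAt 𝓘(ℝ, ℝ) 𝓘(ℝ, ℝ) t
        (fun t : MetricManifold.openInterval => (t : ℝ))
        =ᶠ[𝓝[range 𝓘(ℝ, ℝ)] (extChartAt 𝓘(ℝ, ℝ) t t)] id := by
      filter_upwards [extChartAt_target_mem_nhdsWithin t] with y hy
      have := (extChartAt 𝓘(ℝ, ℝ) t).right_inv hy
      rw [extChartAt_openInterval] at this
      simpa only [writtenInExtChartAt, extChartAt_model_space_eq_id, PartialEquiv.refl_coe,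
        Function.comp_apply, id] using this
    exact HasFDerivWithinAt.congr_of_eventuallyEq (hasFDerivWithinAt_id _ _) heq
      (heq.eq_of_nhdsWithin (mem_range_self _))
  exact h.mfderiv

theorem isPseudoRiemannian_subProductMetric [IsManifold I ∞ M] [IsManifold I' ∞ M']
    {g : BilinField I M} {g' : BilinField I' M'}
    (hg : IsPseudoRiemannian I g) (hg' : IsPseudoRiemannian I' g') :
    IsPseudoRiemannian (I.prod (I'.prod 𝓘(ℝ, ℝ))) (subProductMetric g g') := by
  refine IsPseudoRiemannian.smul (isPseudoRiemannian_threefoldMetric hg hg' (by fun_prop)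
    (by fun_prop) contMDiff_openInterval_val (fun t => by positivity)
    (fun t => pow_ne_zero 2 ?_) fun t => ?_) ?_ fun x => ?_
  · nlinarith [t.2.1, t.2.2]
  · rw [diffAt_openInterval_val]
    exact Function.injective_id
  · intro x
    have h : ContDiffAt ℝ ∞ (fun r : ℝ => (r ^ 2)⁻¹) (x.2.2 : ℝ) :=
      (contDiffAt_id.pow 2).inv (pow_ne_zero 2 x.2.2.2.1.ne')
    exact ContMDiffAt.comp (g := fun r : ℝ => (r ^ 2)⁻¹)
      (f := fun x : M × M' × MetricManifold.openInterval => (x.2.2 : ℝ)) x h.contMDiffAt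
      (contMDiff_openInterval_val.comp (contMDiff_snd.comp contMDiff_snd)).contMDiffAt
  · exact inv_ne_zero (pow_ne_zero 2 x.2.2.2.1.ne')

variable [I.Boundaryless] [I'.Boundaryless]

theorem contDiffAt_chartMetric [IsManifold I ∞ M] {g : BilinField I M}
    (hg : IsPseudoRiemannian I g) (x : M) :
    ContDiffAt ℝ ∞ (chartMetric I g x) (extChartAt I x x) := by
  have h := isSmoothField_iff.1 hg.contMDiff x
  rwa [I.range_eq_univ, contDiffWithinAt_univ] at h

theorem ricci_chartMetric_self [IsManifold I ∞ M] {g : BilinField I M} {c : ℝ}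
    (hg : HasEinsteinConstant I g c) (x : M) (u v : E) :
    Coord.ricci (chartMetric I g x) univ (extChartAt I x x) u v =
      c * chartMetric I g x (extChartAt I x x) u v := by
  rw [chartMetric_self, ← I.range_eq_univ]
  exact hg x u v

/-- If `Ric(g) = -(p - 1) g` and `Ric(g') = (q - 1) g'`, where `p` and `q` are the dimensions of `M`
and `M'`, the sub-product metric has Ricci tensor `-(p + q)` times itself. -/
theorem hasEinsteinConstant_subProductMetric [FiniteDimensional ℝ E] [FiniteDimensional ℝ E']
    [IsManifold I ∞ M] [IsManifold I' ∞ M'] {g : BilinField I M} {g' : BilinField I' M'}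
    (hg : IsPseudoRiemannian I g) (hg' : IsPseudoRiemannian I' g')
    (hRg : HasEinsteinConstant I g (-((Module.finrank ℝ E : ℝ) - 1)))
    (hRg' : HasEinsteinConstant I' g' ((Module.finrank ℝ E' : ℝ) - 1)) :
    HasEinsteinConstant (I.prod (I'.prod 𝓘(ℝ, ℝ))) (subProductMetric g g')
      (-((Module.finrank ℝ E : ℝ) + Module.finrank ℝ E')) := by
  intro x
  set J := I.prod (I'.prod 𝓘(ℝ, ℝ))
  intro u v
  have hev : chartMetric J (subProductMetric g g') x =ᶠ[𝓝 (extChartAt J x x)] _ :=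
    Filter.eventually_of_mem (extChartAt_target_mem_nhds x)
      fun y hy => chartMetric_subProductMetric g g' x hy
  have hx : extChartAt J x x =
      (extChartAt I x.1 x.1, extChartAt I' x.2.1 x.2.1, (x.2.2 : ℝ)) := by
    simp only [J, extChartAt_prod, PartialEquiv.prod_coe, extChartAt_openInterval]
  have key := Coord.ricci_warped_poincare (A := chartMetric I g x.1)
    (B := chartMetric I' g' x.2.1) (y := (extChartAt I x.1 x.1, extChartAt I' x.2.1 x.2.1,
      (x.2.2 : ℝ))) x.2.2.2
    ((contDiffAt_chartMetric hg x.1).of_le (WithTop.coe_le_coe.2 (le_top : (2 : ℕ∞) ≤ ⊤)))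
    ((contDiffAt_chartMetric hg' x.2.1).of_le (WithTop.coe_le_coe.2 (le_top : (2 : ℕ∞) ≤ ⊤)))
    (isInvertible_chartMetric_self hg x.1) (isInvertible_chartMetric_self hg' x.2.1)
    (chartMetric_symm hg.symm x.1) (chartMetric_symm hg'.symm x.2.1)
    (ricci_chartMetric_self hRg x.1) (ricci_chartMetric_self hRg' x.2.1) u v
  rw [← hx, ← Coord.ricci_congr hev, ← hev.eq_of_nhds, chartMetric_self, ← J.range_eq_univ] at key
  exact key

end Einstein

/-! ### The compactified sub-product and its boundary -/

namespace MetricManifold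

/-- The coordinate on the half-open interval `[0, 2)`. -/
def halfOpenCoord (t : halfOpenInterval) : ℝ := t.1.1 0

theorem halfOpenCoord_injective : Function.Injective halfOpenCoord := fun s t h => by
  refine Subtype.ext (Subtype.ext ?_)
  ext i
  rw [Subsingleton.elim i 0]
  exact h

theorem extChartAt_halfOpenInterval (t s : halfOpenInterval) :
    extChartAt (𝓡∂ 1) t s = s.1.1 := by
  simp [extChartAt]
  rfl

theorem contMDiff_halfOpenCoord {n : WithTop ℕ∞} :
    ContMDiff (𝓡∂ 1) 𝓘(ℝ, ℝ) n halfOpenCoord := by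
  have h : ContMDiff 𝓘(ℝ, EuclideanSpace ℝ (Fin 1)) 𝓘(ℝ, ℝ) n
      (EuclideanSpace.proj (0 : Fin 1) : EuclideanSpace ℝ (Fin 1) →L[ℝ] ℝ) :=
    ContinuousLinearMap.contMDiff _
  have h' : ContMDiff (𝓡∂ 1) 𝓘(ℝ, EuclideanSpace ℝ (Fin 1)) n (𝓡∂ 1) :=
    (𝓡∂ 1).contMDiff
  exact h.comp (h'.comp contMDiff_subtype_val)

theorem diffAt_halfOpenCoord (t : halfOpenInterval) :
    diffAt (𝓡∂ 1) 𝓘(ℝ, ℝ) halfOpenCoord t = EuclideanSpace.proj (0 : Fin 1) := by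
  have h : HasMFDerivAt (𝓡∂ 1) 𝓘(ℝ, ℝ) halfOpenCoord t
      (EuclideanSpace.proj (0 : Fin 1) : EuclideanSpace ℝ (Fin 1) →L[ℝ] ℝ) := by
    refine ⟨(contMDiff_halfOpenCoord (n := 0)).continuous.continuousAt, ?_⟩
    have heq : writtenInExtChartAt (𝓡∂ 1) 𝓘(ℝ, ℝ) t halfOpenCoord
        =ᶠ[𝓝[range (𝓡∂ 1)] (extChartAt (𝓡∂ 1) t t)]
        (EuclideanSpace.proj (0 : Fin 1) : EuclideanSpace ℝ (Fin 1) →L[ℝ] ℝ) := by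
      filter_upwards [extChartAt_target_mem_nhdsWithin t] with y hy
      have := (extChartAt (𝓡∂ 1) t).right_inv hy
      rw [extChartAt_halfOpenInterval] at this
      simp only [writtenInExtChartAt, extChartAt_model_space_eq_id, PartialEquiv.refl_coe,
        Function.comp_apply, id, halfOpenCoord, this]
      rfl
    exact HasFDerivWithinAt.congr_of_eventuallyEq
      (ContinuousLinearMap.hasFDerivWithinAt _) heq (heq.eq_of_nhdsWithin (mem_range_self _))
  exact h.mfderiv

theorem mem_boundary_halfOpenInterval {t : halfOpenInterval} :
    t ∈ (𝓡∂ 1).boundary halfOpenInterval ↔ halfOpenCoord t = 0 := by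
  change (𝓡∂ 1).IsBoundaryPoint t ↔ _
  rw [ModelWithCorners.isBoundaryPoint_iff, extChartAt_halfOpenInterval,
    frontier_range_modelWithCornersEuclideanHalfSpace]
  exact eq_comm

theorem isSmoothEmbedding_intervalIncl :
    IsSmoothEmbedding 𝓘(ℝ, ℝ) (𝓡∂ 1) ∞ intervalIncl := by
  have hcont : Continuous intervalIncl := by
    refine Continuous.subtype_mk (Continuous.subtype_mk ?_ _) _
    exact (PiLp.continuous_toLp 2 _).comp (continuous_pi fun _ => continuous_subtype_val)
  refine ⟨IsImmersionOfComplement.isImmersion (F := PUnit) fun t => ?_, ?_⟩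
  · refine IsImmersionAtOfComplement.mk_of_continuousAt hcont.continuousAt
      ((ContinuousLinearEquiv.prodUnique ℝ ℝ PUnit).trans
        ((ContinuousLinearEquiv.funUnique (Fin 1) ℝ ℝ).symm.trans
          (EuclideanSpace.equiv (Fin 1) ℝ).symm))
      (chartAt ℝ t) (chartAt (EuclideanHalfSpace 1) (intervalIncl t)) (mem_chart_source _ _)
      (mem_chart_source _ _) (IsManifold.chart_mem_maximalAtlas t)
      (IsManifold.chart_mem_maximalAtlas _) fun y hy => ?_
    have h := (extChartAt 𝓘(ℝ, ℝ) t).right_inv hy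
    rw [extChartAt_openInterval] at h
    change extChartAt (𝓡∂ 1) (intervalIncl t) (intervalIncl ((extChartAt 𝓘(ℝ, ℝ) t).symm y)) = _
    rw [extChartAt_halfOpenInterval]
    ext i
    exact h
  · exact IsEmbedding.of_comp (g := halfOpenCoord) hcont
      (contMDiff_halfOpenCoord (n := 0)).continuous IsEmbedding.subtypeVal

variable (P Q : MetricManifold.{u, v, w})

theorem isSmoothEmbedding_interiorIncl :
    IsSmoothEmbedding (M := P.carrier × Q.carrier × openInterval)
      (P.model.prod (Q.model.prod 𝓘(ℝ, ℝ))) (modelBar P Q) ∞ (interiorIncl P Q) :=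
  IsSmoothEmbedding.prodMap .id (IsSmoothEmbedding.prodMap .id isSmoothEmbedding_intervalIncl)

theorem isSmoothEmbedding_boundaryIncl :
    IsSmoothEmbedding (P.model.prod Q.model) (modelBar P Q) ∞ (boundaryIncl P Q) := by
  have hcont : Continuous (boundaryIncl P Q) := by unfold boundaryIncl; fun_prop
  refine ⟨IsImmersionOfComplement.isImmersion (F := EuclideanSpace ℝ (Fin 1)) fun x => ?_, ?_⟩
  · refine IsImmersionAtOfComplement.mk_of_continuousAt hcont.continuousAt
      (ContinuousLinearEquiv.prodAssoc ℝ P.modelVec Q.modelVec (EuclideanSpace ℝ (Fin 1)))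
      (chartAt _ x) (chartAt _ (boundaryIncl P Q x)) (mem_chart_source _ _)
      (mem_chart_source _ _) (IsManifold.chart_mem_maximalAtlas x)
      (IsManifold.chart_mem_maximalAtlas _) fun y hy => ?_
    have h := (extChartAt (P.model.prod Q.model) x).right_inv hy
    change extChartAt (modelBar P Q) (boundaryIncl P Q x)
      (boundaryIncl P Q ((extChartAt (P.model.prod Q.model) x).symm y)) = (y.1, y.2, 0)
    have h1 := congrArg Prod.fst h
    have h2 := congrArg Prod.snd h
    simp only [extChartAt_prod, PartialEquiv.prod_coe] at h1 h2 ⊢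
    refine Prod.ext h1 (Prod.ext h2 ?_)
    exact extChartAt_halfOpenInterval intervalZero intervalZero
  · exact IsEmbedding.of_comp (g := fun x : SubProductBar P Q => (x.1, x.2.1)) hcont
      (by fun_prop) IsEmbedding.id

theorem mem_boundary_subProductBar {x : SubProductBar P Q} :
    x ∈ (modelBar P Q).boundary (SubProductBar P Q) ↔ coordR P Q x = 0 := by
  rw [modelBar, ModelWithCorners.boundary_of_boundaryless_left,
    ModelWithCorners.boundary_of_boundaryless_left]
  refine Iff.trans ⟨fun h => h.2.2, fun h => ⟨trivial, trivial, h⟩⟩ mem_boundary_halfOpenInterval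

theorem range_boundaryIncl :
    range (boundaryIncl P Q) = (modelBar P Q).boundary (SubProductBar P Q) := by
  ext x
  rw [mem_boundary_subProductBar]
  constructor
  · rintro ⟨y, rfl⟩
    rfl
  · intro hx
    refine ⟨(x.1, x.2.1), Prod.ext rfl (Prod.ext rfl (halfOpenCoord_injective ?_))⟩
    exact hx.symm

theorem coordR_nonneg (x : SubProductBar P Q) : 0 ≤ coordR P Q x := x.2.2.1.2

theorem range_interiorIncl :
    range (interiorIncl P Q) = (modelBar P Q).interior (SubProductBar P Q) := by
  rw [← ModelWithCorners.compl_boundary]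
  ext x
  rw [mem_compl_iff, mem_boundary_subProductBar]
  constructor
  · rintro ⟨y, rfl⟩
    exact y.2.2.2.1.ne'
  · intro hx
    have hpos : 0 < coordR P Q x := lt_of_le_of_ne (coordR_nonneg P Q x) (Ne.symm hx)
    refine ⟨(x.1, x.2.1, ⟨coordR P Q x, hpos, x.2.2.2⟩), ?_⟩
    exact Prod.ext rfl (Prod.ext rfl (halfOpenCoord_injective rfl))

theorem isDefiningFunction_coordR : IsDefiningFunction (modelBar P Q) (coordR P Q) where
  contMDiff := contMDiff_halfOpenCoord.comp (contMDiff_snd.comp contMDiff_snd)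
  nonneg := coordR_nonneg P Q
  eq_zero_iff _ := (mem_boundary_subProductBar P Q).symm
  mfderiv_ne_zero x _ h := by
    have h1 := diffAt_apply_snd_snd (I := P.model) (I' := Q.model) x
      ((contMDiff_halfOpenCoord (n := 1)).mdifferentiableAt (by simp))
      ((0 : P.modelVec), (0 : Q.modelVec), EuclideanSpace.single (0 : Fin 1) (1 : ℝ))
    have h2 : diffAt (modelBar P Q) 𝓘(ℝ, ℝ)
      (fun x : SubProductBar P Q => halfOpenCoord x.2.2) x = 0 := h
    rw [h2, diffAt_halfOpenCoord] at h1
    simp at h1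

end MetricManifold

section Compactification

variable {E : Type*} [NormedAddCommGroup E] [NormedSpace ℝ E]
  {H : Type*} [TopologicalSpace H] {I : ModelWithCorners ℝ E H}
  {M : Type*} [TopologicalSpace M] [ChartedSpace H M]
  {E' : Type*} [NormedAddCommGroup E'] [NormedSpace ℝ E']
  {H' : Type*} [TopologicalSpace H'] {I' : ModelWithCorners ℝ E' H'}
  {M' : Type*} [TopologicalSpace M'] [ChartedSpace H' M']
  {E'' : Type*} [NormedAddCommGroup E''] [NormedSpace ℝ E'']
  {H'' : Type*} [TopologicalSpace H''] {I'' : ModelWithCorners ℝ E'' H''}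
  {M'' : Type*} [TopologicalSpace M''] [ChartedSpace H'' M'']
  {F : Type*} [NormedAddCommGroup F] [NormedSpace ℝ F]
  {K : Type*} [TopologicalSpace K] {J : ModelWithCorners ℝ F K}
  {N : Type*} [TopologicalSpace N] [ChartedSpace K N]

theorem pullback_threefoldMetric {a b : ℝ → ℝ} {r : M'' → ℝ} (g : BilinField I M)
    (g' : BilinField I' M') {f : N → M × M' × M''} {x : N}
    (hr : MDifferentiableAt I'' 𝓘(ℝ, ℝ) r (f x).2.2)
    (hf : MDifferentiableAt J (I.prod (I'.prod I'')) f x) :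
    pullback J (I.prod (I'.prod I'')) f (threefoldMetric (I'' := I'') a b r g g') x =
      diffSq J (fun x => r (f x).2.2) x + a (r (f x).2.2) • pullback J I (fun x => (f x).1) g x +
        b (r (f x).2.2) • pullback J I' (fun x => (f x).2.1) g' x := by
  have h1 := pullback_comp g (h := fun x : M × M' × M'' => x.1) mdifferentiableAt_fst hf
  have h2 := pullback_comp g' (h := fun x : M × M' × M'' => x.2.1)
    (mdifferentiableAt_fst.comp _ mdifferentiableAt_snd) hf
  have h3 := pullback_comp (I'' := 𝓘(ℝ, ℝ)) (fun _ => ContinuousLinearMap.mul ℝ ℝ)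
    (h := fun x : M × M' × M'' => r x.2.2)
    (hr.comp (f := fun x : M × M' × M'' => x.2.2) _
      (mdifferentiableAt_snd.comp _ mdifferentiableAt_snd)) hf
  exact congrArg₂ (· + ·) (congrArg₂ (· + ·) h3 (congrArg (a (r (f x).2.2) • ·) h1))
    (congrArg (b (r (f x).2.2) • ·) h2)

theorem diffSq_const (c : ℝ) (x : M) : diffSq I (fun _ : M => c) x = 0 := by
  ext u v
  rw [diffSq_apply, mfderiv_const]
  exact mul_zero (0 : ℝ)

end Compactification

/-! ### Poincaré–Einstein sub-products and the recursion -/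

namespace MetricManifold

theorem dim_subProduct (P Q : MetricManifold.{u, v, w}) :
    (P.subProduct Q).dim = P.dim + Q.dim + 1 := by
  change Module.finrank ℝ (P.modelVec × Q.modelVec × ℝ) = _
  simp [dim, add_assoc]

theorem dimBar_eq (P Q : MetricManifold.{u, v, w}) : dimBar P Q = P.dim + Q.dim + 1 := by
  simp [dimBar, dim, add_assoc]

/-- If `Ric = -(dim P - 1)` on `P` and `Ric = dim Q - 1` on `Q`, the sub-product is
Poincaré–Einstein. The compactified metric is `dr² + (1 + r²/4)² G + (1 - r²/4)² g`, whose
restriction to `r = 0` is `G + g`, so that the conformal factor on the boundary is `1`. -/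
theorem isPoincareEinstein_subProduct (P Q : MetricManifold.{u, v, w})
    (hP : IsPseudoRiemannian P.model P.metric) (hQ : IsPseudoRiemannian Q.model Q.metric)
    (hRP : HasEinsteinConstant P.model P.metric (-((P.dim : ℝ) - 1)))
    (hRQ : HasEinsteinConstant Q.model Q.metric ((Q.dim : ℝ) - 1)) :
    IsPoincareEinstein (M := (P.subProduct Q).carrier) (M' := P.carrier × Q.carrier)
      (X := SubProductBar P Q) (P.subProduct Q).model (P.model.prod Q.model) (modelBar P Q)
      (interiorIncl P Q) (boundaryIncl P Q) (coordR P Q) (P.subProduct Q).metric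
      (prodMetric P.model Q.model P.metric Q.metric) where
  interior_embedding := isSmoothEmbedding_interiorIncl P Q
  range_interior := range_interiorIncl P Q
  boundary_embedding := isSmoothEmbedding_boundaryIncl P Q
  range_boundary := range_boundaryIncl P Q
  definingFunction := isDefiningFunction_coordR P Q
  metric := isPseudoRiemannian_subProductMetric hP hQ
  boundaryMetric := hP.prodMetric hQ
  einstein := by
    have h := hasEinsteinConstant_subProductMetric hP hQ hRP hRQ
    rw [Module.finrank_prod, Nat.cast_add]
    exact h
  conformalInfinity := by
    have hd : ∀ t, MDifferentiableAt (𝓡∂ 1) 𝓘(ℝ, ℝ) halfOpenCoord t := fun t =>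
      (contMDiff_halfOpenCoord (n := 1)).mdifferentiableAt (by simp)
    refine ⟨threefoldMetric (I'' := 𝓡∂ 1) (fun r => (1 + r ^ 2 / 4) ^ 2)
      (fun r => (1 - r ^ 2 / 4) ^ 2) halfOpenCoord P.metric Q.metric, ?_, fun x => ?_,
      fun _ => 1, contMDiff_const, fun _ => one_pos, fun y => ?_⟩
    · refine isPseudoRiemannian_threefoldMetric hP hQ (by fun_prop) (by fun_prop)
        contMDiff_halfOpenCoord (fun t => by positivity) (fun t => pow_ne_zero 2 ?_) fun t => ?_
      · have h0 : 0 ≤ halfOpenCoord t := t.1.2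
        have h2 : halfOpenCoord t < 2 := t.2
        nlinarith
      · rw [diffAt_halfOpenCoord]
        intro u v huv
        ext i
        rw [Subsingleton.elim i 0]
        exact huv
    · have h := pullback_threefoldMetric (I'' := 𝓡∂ 1) (N := P.carrier × Q.carrier × openInterval)
        (J := P.model.prod (Q.model.prod 𝓘(ℝ, ℝ))) (a := fun r => (1 + r ^ 2 / 4) ^ 2)
        (b := fun r => (1 - r ^ 2 / 4) ^ 2) P.metric Q.metric (hd (interiorIncl P Q x).2.2)
        ((isSmoothEmbedding_interiorIncl P Q).contMDiff.mdifferentiableAt (by simp))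
      refine h.trans ?_
      have hx : (coordR P Q (interiorIncl P Q x)) ^ 2 ≠ 0 := pow_ne_zero 2 x.2.2.2.1.ne'
      exact (smul_inv_smul₀ hx _).symm
    · have h := pullback_threefoldMetric (I'' := 𝓡∂ 1) (a := fun r => (1 + r ^ 2 / 4) ^ 2)
        (b := fun r => (1 - r ^ 2 / 4) ^ 2) P.metric Q.metric (hd (boundaryIncl P Q y).2.2)
        ((isSmoothEmbedding_boundaryIncl P Q).contMDiff.mdifferentiableAt (by simp))
      refine h.trans ?_
      have h0 : ∀ y, halfOpenCoord (boundaryIncl P Q y).2.2 = 0 := fun _ => rfl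
      simp only [h0, diffSq_const]
      norm_num
      rfl

theorem dim_tower (M : ℕ → MetricManifold.{u, v, w}) (s : ℕ) :
    (tower M s).dim = s + ∑ i ∈ Finset.range (s + 1), (M i).dim := by
  induction s with
  | zero => simp [tower]
  | succ s ih =>
    rw [tower, dim_subProduct, ih, Finset.sum_range_succ _ (s + 1)]
    ring

/-- Every stage of the recursion is a pseudo-Riemannian Einstein manifold with the constant
`-(dim - 1)` that the next stage needs. -/
theorem tower_einstein (M : ℕ → MetricManifold.{u, v, w}) (n : ℕ)
    (hM : ∀ i ≤ n, IsPseudoRiemannian (M i).model (M i).metric)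
    (h0 : HasEinsteinConstant (M 0).model (M 0).metric (-(((M 0).dim : ℝ) - 1)))
    (hpos : ∀ i, 1 ≤ i → i ≤ n →
      HasEinsteinConstant (M i).model (M i).metric (((M i).dim : ℝ) - 1)) :
    ∀ s ≤ n, IsPseudoRiemannian (tower M s).model (tower M s).metric ∧
      HasEinsteinConstant (tower M s).model (tower M s).metric (-(((tower M s).dim : ℝ) - 1)) := by
  intro s
  induction s with
  | zero => exact fun _ => ⟨hM 0 (Nat.zero_le n), h0⟩
  | succ s ih =>
    intro hs
    obtain ⟨h1, h2⟩ := ih (by omega)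
    refine ⟨isPseudoRiemannian_subProductMetric h1 (hM _ hs), ?_⟩
    have hd : -(((tower M (s + 1)).dim : ℝ) - 1) =
        -(((tower M s).dim : ℝ) + (M (s + 1)).dim) := by
      rw [tower, dim_subProduct]
      push_cast
      ring
    rw [hd]
    exact hasEinsteinConstant_subProductMetric h1 (hM _ hs) h2 (hpos _ (by omega) hs)

end MetricManifold

/-- `M 0` is the negative Einstein space `(M₀, g₀)` and `M 1, …, M ℓ` are the positive Einstein
spaces, where `ℓ = k + 1`. The manifold `M^{s+}` with its metric `G^s` is `tower M s`, and
`M^{(ℓ-1)+} × M_ℓ × [0, 2)` is `SubProductBar (tower M k) (M (k + 1))`. -/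
theorem theorem8p1 (M : ℕ → MetricManifold.{u, v, w}) (k : ℕ)
    (hEinstein : ∀ i ≤ k + 1, IsEinstein (M i).model (M i).metric)
    (hdim : ∀ i ≤ k + 1, 2 ≤ (M i).dim)
    (hneg : ∀ x : (M 0).carrier,
      scalarCurvature (M 0).model (M 0).metric x = -(((M 0).dim : ℝ) * ((M 0).dim - 1)))
    (hpos : ∀ i, 1 ≤ i → i ≤ k + 1 → ∀ x : (M i).carrier,
      scalarCurvature (M i).model (M i).metric x = ((M i).dim : ℝ) * ((M i).dim - 1)) :
    MetricManifold.dimBar (MetricManifold.tower M k) (M (k + 1)) =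
        (k + 1) + ∑ i ∈ Finset.range (k + 2), (M i).dim ∧
      (MetricManifold.tower M (k + 1)).dim = (k + 1) + ∑ i ∈ Finset.range (k + 2), (M i).dim ∧
      IsPoincareEinstein (M := (MetricManifold.tower M (k + 1)).carrier)
        (M' := (MetricManifold.tower M k).carrier × (M (k + 1)).carrier)
        (X := MetricManifold.SubProductBar (MetricManifold.tower M k) (M (k + 1)))
        (MetricManifold.tower M (k + 1)).model
        ((MetricManifold.tower M k).model.prod (M (k + 1)).model)
        (MetricManifold.modelBar (MetricManifold.tower M k) (M (k + 1)))
        (MetricManifold.interiorIncl (MetricManifold.tower M k) (M (k + 1)))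
        (MetricManifold.boundaryIncl (MetricManifold.tower M k) (M (k + 1)))
        (MetricManifold.coordR (MetricManifold.tower M k) (M (k + 1)))
        (MetricManifold.tower M (k + 1)).metric
        (prodMetric (MetricManifold.tower M k).model (M (k + 1)).model
          (MetricManifold.tower M k).metric (M (k + 1)).metric) := by
  have hd0 : ∀ i ≤ k + 1, Module.finrank ℝ (M i).modelVec ≠ 0 := fun i hi =>
    (lt_of_lt_of_le two_pos (hdim i hi)).ne'
  have h0 : HasEinsteinConstant (M 0).model (M 0).metric (-(((M 0).dim : ℝ) - 1)) :=
    hasEinsteinConstant_of_scalarCurvature (hEinstein 0 (Nat.zero_le _)) (hd0 0 (Nat.zero_le _))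
      fun x => (hneg x).trans (mul_neg _ _).symm
  have hi : ∀ i, 1 ≤ i → i ≤ k + 1 →
      HasEinsteinConstant (M i).model (M i).metric (((M i).dim : ℝ) - 1) := fun i h1 hk =>
    hasEinsteinConstant_of_scalarCurvature (hEinstein i hk) (hd0 i hk) (hpos i h1 hk)
  obtain ⟨hP, hRP⟩ := MetricManifold.tower_einstein M (k + 1) (fun i hk => (hEinstein i hk).1) h0 hi
    k (Nat.le_succ k)
  refine ⟨?_, MetricManifold.dim_tower M (k + 1), ?_⟩
  · rw [MetricManifold.dimBar_eq, MetricManifold.dim_tower, Finset.sum_range_succ _ (k + 1)]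
    ring
  · exact MetricManifold.isPoincareEinstein_subProduct _ _ hP (hEinstein _ le_rfl).1 hRP
      (hi _ (Nat.le_add_left 1 k) le_rfl)
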